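/- The class of elementary amenable groups is the smallest class of groups that contains all finite groups and all abelian groups and is closed under isomorphism and under taking subgroups, quotients, extensions and directed unions. The Hirsch length $h(G)\in\{0,1,2,\dots\}\cup\{\infty\}$ of an elementary amenable group $G$ is the invariant determined by the following rules: $h(G)=n$ if $G$ has a subgroup of finite index isomorphic to $\mathbb{Z}^n$; $h(G)=h(N)+h(G/N)$ for every normal subgroup $N$ of $G$; and $h(G)=\sup_i h(G_i)$ if $G$ is the union of a directed family of subgroups $G_i$. The Hirsch--Plotkin radical $\sqrt{G}$ of a group $G$ is its unique maximal locally nilpotent normal subgroup (a group is locally nilpotent if all its finitely generated subgroups are nilpotent). The rank of an abelian group $A$ is the dimension of $\mathbb{Q}\otimes_{\mathbb{Z}}A$ over $\mathbb{Q}$. Theorem. Let $G$ be a torsion-free elementary amenable group of Hirsch length $2$. Then $\sqrt{G}$ is abelian, and either (1) $\sqrt{G}$ has rank $1$ and $G\cong\sqrt{G}\rtimes\mathbb{Z}$, a semidirect product in which the normal factor is the subgroup $\sqrt{G}$ of $G$; or (2) $\sqrt{G}$ has rank $2$ and $[G:\sqrt{G}]\leq2$. -/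

import Mathlib

open scoped IsMulCommutative

universe u

/-- The class of elementary amenable groups: the smallest class of groups (closed under
isomorphism) that contains the finite and the abelian groups and is closed under taking
subgroups, quotients, extensions and directed unions. -/
inductive IsElementaryAmenable : (G : Type u) → [Group G] → Prop
  | of_finite (G : Type u) [Group G] (h : Finite G) : IsElementaryAmenable G
  | of_comm (G : Type u) [Group G] (h : ∀ a b : G, a * b = b * a) : IsElementaryAmenable G
  | of_injective (H G : Type u) [Group H] [Group G] (f : H →* G) (hf : Function.Injective f)
      (hG : IsElementaryAmenable G) : IsElementaryAmenable H
  | of_surjective (G Q : Type u) [Group G] [Group Q] (f : G →* Q) (hf : Function.Surjective f)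
      (hG : IsElementaryAmenable G) : IsElementaryAmenable Q
  | of_extension (G : Type u) [Group G] (N : Subgroup G) [N.Normal]
      (hN : IsElementaryAmenable N) (hQ : IsElementaryAmenable (G ⧸ N)) : IsElementaryAmenable G
  | of_directedUnion (G : Type u) [Group G] (S : Set (Subgroup G))
      (hdir : DirectedOn (· ≤ ·) S) (hcover : ∀ g : G, ∃ K ∈ S, g ∈ K)
      (hS : ∀ K ∈ S, IsElementaryAmenable K) : IsElementaryAmenable G

/-- `HasHirschLength G n` says that the elementary amenable group `G` has Hirsch length
`n ∈ ℕ ∪ {∞}`. The Hirsch length is the invariant of elementary amenable groups that is the rank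
of a free abelian subgroup of finite index when there is one of finite rank, is additive in
extensions, and is the least upper bound of the lengths of the members in a directed union. -/
inductive HasHirschLength : (G : Type u) → [Group G] → ℕ∞ → Prop
  | of_virtuallyFreeAbelian (G : Type u) [Group G] (A : Subgroup G) (hA : A.FiniteIndex) (n : ℕ)
      (e : A ≃* Multiplicative (Fin n → ℤ)) : HasHirschLength G n
  | of_extension (G : Type u) [Group G] (N : Subgroup G) [N.Normal] (m n : ℕ∞)
      (hN : HasHirschLength N m) (hQ : HasHirschLength (G ⧸ N) n) : HasHirschLength G (m + n)
  | of_directedUnion (G : Type u) [Group G] (S : Set (Subgroup G))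
      (hdir : DirectedOn (· ≤ ·) S) (hcover : ∀ g : G, ∃ K ∈ S, g ∈ K)
      (h : Subgroup G → ℕ∞) (hS : ∀ K ∈ S, HasHirschLength K (h K)) :
      HasHirschLength G (⨆ K ∈ S, h K)

/-- A group is locally nilpotent if all its finitely generated subgroups are nilpotent. -/
def IsLocallyNilpotent (G : Type u) [Group G] : Prop :=
  ∀ K : Subgroup G, K.FG → Group.IsNilpotent K

/-- The Hirsch–Plotkin radical `√G`: the subgroup generated by all locally nilpotent normal
subgroups of `G`. By the Hirsch–Plotkin theorem it is itself locally nilpotent, so it is the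
unique maximal locally nilpotent normal subgroup. -/
def hirschPlotkinRadical (G : Type u) [Group G] : Subgroup G :=
  sSup {N : Subgroup G | N.Normal ∧ IsLocallyNilpotent N}

/-! Induction on the derivation of the Hirsch length (`HasHirschLength.structure`) yields three
facts at once: length 0 means locally finite; length at most 1 means that finitely generated
subgroups are locally finite-by-virtually cyclic; a torsion-free group of length at most 2 satisfies
`HasLengthTwoStructure`. That dichotomy is phrased through relations among finitely many elements so
that it survives directed unions. The main case of an extension is a rank one abelian kernel N with
a quotient of length at most 1. On finitely generated subgroups, N is enlarged to absorb the locally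
finite part, and a single t generates the rest up to finite index. Either a power of t centralizes N
and the group is virtually abelian, or the centralizer of N has rank one.

In the rank one by rank one case, an element outside C(a) acts on C(a) without nontrivial fixed
points, so it lies in no locally nilpotent normal subgroup, and √G = C(a). Conjugation on a gives a
character G → ℚ* with kernel C(a). A suitable p-adic valuation turns it into a map to ℤ with the
same kernel, and the extension splits.

In the virtually abelian case, let B be generated by the squares and let C be its centralizer. C is
abelian, being torsion-free and central-by-locally finite. An element outside C inverts some
nontrivial element of B, which forces √G = C. The quotient G/C acts on B, of rank at most 2, by
commuting involutions. An element x outside C fixes x², so it never acts as -1; hence only one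
nontrivial action remains (`mul_mem_of_notMem`) and the index is at most 2. If C had rank at most 1,
any two elements of G would be dependent and `HasHirschLength.le_one_of_dep` would give length at
most 1. -/

/-- A group is torsion-free if no nontrivial element has a trivial nonzero power. -/
def IsTorsionFreeGroup (G : Type u) [Group G] : Prop :=
  ∀ (g : G) (n : ℤ), n ≠ 0 → g ^ n = 1 → g = 1

/-- A subgroup is abelian of rank at most one (up to torsion). -/
structure IsAbelianRankLEOne {G : Type u} [Group G] (A : Subgroup G) : Prop where
  comm : ∀ x ∈ A, ∀ y ∈ A, Commute x y
  dep : ∀ x ∈ A, ∀ y ∈ A, ∃ m n : ℤ, (m ≠ 0 ∨ n ≠ 0) ∧ x ^ m = y ^ n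

/-- Relative local finiteness: `A` has finite index in all finitely generated subgroups of `C`
up to intersection. -/
def IsLocallyFiniteIn {G : Type u} [Group G] (A C : Subgroup G) : Prop :=
  ∀ H : Subgroup G, H.FG → H ≤ C → A.relIndex H ≠ 0

/-! ### Torsion-free groups, rank one abelian subgroups and locally finite extensions of them. -/

section Basic

variable {G : Type u} [Group G]

theorem isTorsionFreeGroup_of_isOfFinOrder (h : ∀ g : G, IsOfFinOrder g → g = 1) :
    IsTorsionFreeGroup G :=
  fun g n hn hg => h g (isOfFinOrder_iff_zpow_eq_one.mpr ⟨n, hn, hg⟩)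

theorem IsTorsionFreeGroup.of_injective {H : Type*} [Group H] (hG : IsTorsionFreeGroup G)
    (f : H →* G) (hf : Function.Injective f) : IsTorsionFreeGroup H := by
  intro h n hn hh
  apply hf
  rw [map_one]
  exact hG _ n hn (by rw [← map_zpow, hh, map_one])

theorem IsTorsionFreeGroup.subgroup (hG : IsTorsionFreeGroup G) (H : Subgroup G) :
    IsTorsionFreeGroup H :=
  hG.of_injective H.subtype H.subtype_injective

theorem IsTorsionFreeGroup.eq_of_zpow_eq (hG : IsTorsionFreeGroup G) {a b : G}
    (hab : Commute a b) {n : ℤ} (hn : n ≠ 0) (h : a ^ n = b ^ n) : a = b := by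
  have h1 : (a * b⁻¹) ^ n = 1 := by
    rw [(hab.inv_right).mul_zpow, h, inv_zpow, mul_inv_cancel]
  exact mul_inv_eq_one.mp (hG _ n hn h1)

theorem IsTorsionFreeGroup.commute_of_commute_zpow (hG : IsTorsionFreeGroup G) {x a : G}
    (hc : Commute (x * a * x⁻¹) a) {n : ℤ} (hn : n ≠ 0) (h : Commute x (a ^ n)) :
    Commute x a := by
  have h1 : x * a * x⁻¹ = a := by
    apply hG.eq_of_zpow_eq hc hn
    rw [conj_zpow, h.eq, mul_inv_cancel_right]
  exact mul_inv_eq_iff_eq_mul.mp h1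

/-- In an abelian rank one subgroup the centralizers of nontrivial elements are as large as
possible. -/
theorem IsAbelianRankLEOne.commute_of_commute (hG : IsTorsionFreeGroup G) {A : Subgroup G}
    (hA : IsAbelianRankLEOne A) {x a b : G} (ha : a ∈ A) (hb : b ∈ A)
    (hxb : x * b * x⁻¹ ∈ A) (ha1 : a ≠ 1) (h : Commute x a) : Commute x b := by
  obtain ⟨m, n, hmn, e⟩ := hA.dep a ha b hb
  have hn : n ≠ 0 := by
    rintro rfl
    rw [zpow_zero] at e
    exact ha1 (hG a m (by tauto) e)
  exact hG.commute_of_commute_zpow (hA.comm _ hxb _ hb) hn (e ▸ h.zpow_right m)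

theorem IsAbelianRankLEOne.mono {A B : Subgroup G} (hB : IsAbelianRankLEOne B) (h : A ≤ B) :
    IsAbelianRankLEOne A :=
  ⟨fun x hx y hy => hB.comm x (h hx) y (h hy), fun x hx y hy => hB.dep x (h hx) y (h hy)⟩

/-- A torsion-free subgroup that is locally finite modulo a central subgroup is abelian. -/
theorem commute_of_isLocallyFiniteIn (hG : IsTorsionFreeGroup G) {A C : Subgroup G}
    (hcen : ∀ a ∈ A, ∀ c ∈ C, Commute a c) (hlf : IsLocallyFiniteIn A C) :
    ∀ x ∈ C, ∀ y ∈ C, Commute x y := by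
  intro x hx y hy
  set H := Subgroup.closure ({x, y} : Set G) with hH
  have hHC : H ≤ C := by
    rw [hH, Subgroup.closure_le]
    rintro z (rfl | rfl) <;> assumption
  have hfg : H.FG := (Subgroup.fg_iff H).mpr ⟨{x, y}, rfl, by simp⟩
  have hxH : x ∈ H := Subgroup.subset_closure (by simp)
  have hyH : y ∈ H := Subgroup.subset_closure (by simp)
  have hind : (A.subgroupOf H).index ≠ 0 := hlf H hfg hHC
  have hle : A.subgroupOf H ≤ Subgroup.center H := by
    intro a ha
    rw [Subgroup.mem_center_iff]
    intro h
    exact Subtype.ext (hcen _ (Subgroup.mem_subgroupOf.mp ha) _ (hHC h.2)).eq.symm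
  have hfin : (Subgroup.center H).index ≠ 0 := fun h0 =>
    hind (by
      have := Subgroup.index_dvd_of_le hle
      rw [h0] at this
      exact Nat.eq_zero_of_zero_dvd this)
  have : (Subgroup.center H).FiniteIndex := ⟨hfin⟩
  set u : H := ⟨x, hxH⟩
  set v : H := ⟨y, hyH⟩
  -- The transfer into the center is the power map with exponent the index of the center. Its target
  -- is commutative, so it kills commutators, which are therefore torsion.
  have h1 : MonoidHom.transferCenterPow H (u * v * u⁻¹ * v⁻¹) = 1 := by
    rw [map_mul, map_mul, map_mul, map_inv, map_inv, mul_inv_eq_one, mul_inv_eq_iff_eq_mul]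
    exact Subtype.ext (Subgroup.mem_center_iff.mp (MonoidHom.transferCenterPow H v).2 _)
  have h2 : (u * v * u⁻¹ * v⁻¹) ^ ((Subgroup.center H).index : ℤ) = 1 := by
    rw [zpow_natCast, ← MonoidHom.transferCenterPow_apply, h1]; rfl
  have h3 := hG.subgroup H _ _ (Int.natCast_ne_zero.mpr hfin) h2
  rw [mul_inv_eq_one, mul_inv_eq_iff_eq_mul] at h3
  exact congrArg Subtype.val h3

/-- An element with a nontrivial power in an abelian rank one subgroup that it normalizes
centralizes that subgroup. -/
theorem IsAbelianRankLEOne.commute_of_zpow_mem (hG : IsTorsionFreeGroup G) {N : Subgroup G}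
    (hN : IsAbelianRankLEOne N) {g : G} (hg : ∀ a ∈ N, g * a * g⁻¹ ∈ N) {n : ℤ} (hn : n ≠ 0)
    (hgn : g ^ n ∈ N) : ∀ a ∈ N, Commute g a := by
  intro a ha
  by_cases h1 : g = 1
  · rw [h1]; exact Commute.one_left a
  · exact hN.commute_of_commute hG hgn ha (hg a ha) (fun h => h1 (hG g n hn h))
      (Commute.self_zpow g n)

theorem IsLocallyFiniteIn.exists_pow_mem {A C : Subgroup G} (h : IsLocallyFiniteIn A C) {g : G}
    (hg : g ∈ C) : ∃ n : ℕ, n ≠ 0 ∧ g ^ n ∈ A := by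
  obtain ⟨n, hn, -, hgn⟩ := Subgroup.exists_pow_mem_of_relIndex_ne_zero
    (h (Subgroup.zpowers g) ((Subgroup.fg_iff _).mpr
      ⟨{g}, Subgroup.zpowers_eq_closure g ▸ rfl, by simp⟩)
      (Subgroup.zpowers_le.mpr hg)) (Subgroup.mem_zpowers g)
  exact ⟨n, hn.ne', hgn.1⟩

theorem IsLocallyFiniteIn.exists_zpow_mem {A C : Subgroup G} (h : IsLocallyFiniteIn A C) {g : G}
    (hg : g ∈ C) : ∃ n : ℤ, n ≠ 0 ∧ g ^ n ∈ A := by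
  obtain ⟨n, hn, hgn⟩ := h.exists_pow_mem hg
  exact ⟨n, Int.natCast_ne_zero.mpr hn, by rwa [zpow_natCast]⟩

theorem IsLocallyFiniteIn.mono_right {A C D : Subgroup G} (h : IsLocallyFiniteIn A D)
    (hCD : C ≤ D) : IsLocallyFiniteIn A C :=
  fun H hH hHC => h H hH (hHC.trans hCD)

theorem Subgroup.relIndex_ne_zero_of_index_ne_zero {A : Subgroup G} (h : A.index ≠ 0)
    (H : Subgroup G) : A.relIndex H ≠ 0 := by
  have : A.FiniteIndex := ⟨h⟩
  exact (inferInstance : (A.subgroupOf H).FiniteIndex).index_ne_zero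

theorem IsLocallyFiniteIn.of_index_ne_zero {A : Subgroup G} (h : A.index ≠ 0) (C : Subgroup G) :
    IsLocallyFiniteIn A C :=
  fun H _ _ => Subgroup.relIndex_ne_zero_of_index_ne_zero h H

theorem exists_zpow_eq_of_zpow {x y : G} {p q m n : ℤ} (hp : p ≠ 0) (hq : q ≠ 0)
    (hmn : m ≠ 0 ∨ n ≠ 0) (h : (x ^ p) ^ m = (y ^ q) ^ n) :
    ∃ m n : ℤ, (m ≠ 0 ∨ n ≠ 0) ∧ x ^ m = y ^ n :=
  ⟨p * m, q * n, hmn.imp (mul_ne_zero hp) (mul_ne_zero hq), by rw [zpow_mul, zpow_mul, h]⟩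

/-- A torsion-free extension of an abelian group of rank one by a locally finite group is
abelian of rank one. -/
theorem IsAbelianRankLEOne.of_isLocallyFiniteIn (hG : IsTorsionFreeGroup G) {N C : Subgroup G}
    (hN : IsAbelianRankLEOne N) (hnorm : ∀ g ∈ C, ∀ a ∈ N, g * a * g⁻¹ ∈ N)
    (hlf : IsLocallyFiniteIn N C) : IsAbelianRankLEOne C := by
  refine ⟨commute_of_isLocallyFiniteIn hG (fun a ha c hc => ?_) hlf, fun x hx y hy => ?_⟩
  · obtain ⟨n, hn, h⟩ := hlf.exists_zpow_mem hc
    exact (hN.commute_of_zpow_mem hG (hnorm c hc) hn h a ha).symm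
  · obtain ⟨p, hp, hxp⟩ := hlf.exists_zpow_mem hx
    obtain ⟨q, hq, hyq⟩ := hlf.exists_zpow_mem hy
    obtain ⟨m, n, hmn, e⟩ := hN.dep _ hxp _ hyq
    exact exists_zpow_eq_of_zpow hp hq hmn e

end Basic

/-! ### The two structural types, and finite order automorphisms in rank two. -/

section Types

/-- Torsion-free virtually abelian groups of Hirsch length at most two: squares commute, and
any three squares are dependent. -/
structure IsVirtuallyAbelianRankLETwo (G : Type u) [Group G] : Prop where
  comm : ∀ x y : G, Commute (x ^ 2) (y ^ 2)
  dep : ∀ x y z : G, ∃ i j k : ℤ, (i ≠ 0 ∨ j ≠ 0 ∨ k ≠ 0) ∧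
    (x ^ 2) ^ i * (y ^ 2) ^ j * (z ^ 2) ^ k = 1

/-- The centralizer of `a` is a normal abelian subgroup of rank one, and the quotient by it is
nontrivial of rank one. -/
structure IsRankOneByRankOne (G : Type u) [Group G] (a : G) : Prop where
  ne_one : a ≠ 1
  normal : ∀ x g : G, Commute x a → Commute (g * x * g⁻¹) a
  rank : IsAbelianRankLEOne (Subgroup.centralizer {a})
  exists_not_commute : ∃ t : G, ¬ Commute t a
  dep : ∀ g h : G, ∃ m n : ℤ, (m ≠ 0 ∨ n ≠ 0) ∧ Commute (g ^ m * h ^ n) a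

/-- The structural dichotomy for torsion-free groups of Hirsch length at most two. -/
def HasLengthTwoStructure (G : Type u) [Group G] : Prop :=
  IsVirtuallyAbelianRankLETwo G ∨ ∃ a : G, IsRankOneByRankOne G a

variable {G : Type u} [Group G]

theorem mem_centralizer_singleton {a x : G} :
    x ∈ Subgroup.centralizer {a} ↔ Commute x a := by
  rw [Subgroup.mem_centralizer_singleton_iff]
  exact Iff.rfl

theorem IsVirtuallyAbelianRankLETwo.of_injective {H : Type*} [Group H]
    (hG : IsVirtuallyAbelianRankLETwo G) (f : H →* G) (hf : Function.Injective f) :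
    IsVirtuallyAbelianRankLETwo H := by
  refine ⟨fun x y => hf ?_, fun x y z => ?_⟩
  · simpa using (hG.comm (f x) (f y)).eq
  · obtain ⟨i, j, k, h0, h⟩ := hG.dep (f x) (f y) (f z)
    exact ⟨i, j, k, h0, hf (by simpa using h)⟩

/-- If g scales w by the ratio j/k, then its n-th power scales w by the n-th power of that ratio. -/
theorem conj_pow_zpow_eq {g w : G} {j k : ℤ} (h : (g * w * g⁻¹) ^ k = w ^ j) (n : ℕ) :
    (g ^ n * w * (g ^ n)⁻¹) ^ (k ^ n) = w ^ (j ^ n) := by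
  induction n with
  | zero => simp
  | succ n ih =>
    have h1 : g ^ (n + 1) * w * (g ^ (n + 1))⁻¹ = g * (g ^ n * w * (g ^ n)⁻¹) * g⁻¹ := by
      rw [pow_succ' g n]; group
    rw [h1, pow_succ, zpow_mul, conj_zpow, ih, ← conj_zpow, zpow_comm, h, ← zpow_mul,
      pow_succ']

theorem conj_pow_eq_of_conj_eq {g w b : G} (hb : g * b * g⁻¹ = w * b) (hw : Commute g w) (n : ℕ) :
    g ^ n * b * (g ^ n)⁻¹ = w ^ n * b := by
  induction n with
  | zero => simp
  | succ n ih =>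
    have h1 : g ^ (n + 1) * b * (g ^ (n + 1))⁻¹ = g * (g ^ n * b * (g ^ n)⁻¹) * g⁻¹ := by
      rw [pow_succ' g n]; group
    have h2 : g * (w ^ n * b) * g⁻¹ = w ^ n * (g * b * g⁻¹) := by
      rw [← mul_assoc, (hw.pow_right n).eq]; group
    rw [h1, ih, h2, hb, ← mul_assoc, pow_succ]

/-- A finite order automorphism of a torsion-free abelian group of rank two with a nontrivial
fixed element is an involution. -/
theorem commute_sq_of_pow_mem (hG : IsTorsionFreeGroup G) (A : Subgroup G) [hA : A.Normal]
    (hcomm : ∀ x ∈ A, ∀ y ∈ A, Commute x y)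
    (hdep : ∀ x ∈ A, ∀ y ∈ A, ∀ z ∈ A, ∃ i j k : ℤ, (i ≠ 0 ∨ j ≠ 0 ∨ k ≠ 0) ∧
      x ^ i * y ^ j * z ^ k = 1) {g : G} {n : ℕ} (hn : n ≠ 0) (hgn : g ^ n ∈ A)
    {b : G} (hb : b ∈ A) : Commute (g ^ 2) b := by
  by_cases hg1 : g = 1
  · rw [hg1, one_pow]; exact Commute.one_left b
  have hn' : (n : ℤ) ≠ 0 := Int.natCast_ne_zero.mpr hn
  have hfix : ∀ x ∈ A, g ^ n * x * (g ^ n)⁻¹ = x := fun x hx => by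
    rw [(hcomm _ hgn _ hx).eq, mul_inv_cancel_right]
  -- Additively, w = (g - 1)b. The plan is to show that w is an eigenvector of g.
  set w := g * b * g⁻¹ * b⁻¹ with hw
  have hgb : g * b * g⁻¹ = w * b := by rw [hw]; group
  have hgbA : g * b * g⁻¹ ∈ A := hA.conj_mem b hb g
  have hwA : w ∈ A := mul_mem hgbA (inv_mem hb)
  have hgwA : g * w * g⁻¹ ∈ A := hA.conj_mem w hwA g
  obtain ⟨i, j, k, h0, h⟩ := hdep _ hgn _ hb _ hgbA
  have hgn1 : g ^ n ≠ 1 := fun h1 => hg1 (hG g n hn' (by rw [zpow_natCast, h1]))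
  -- Conjugation by g fixes the term in g ^ n. Subtracting the relation from its conjugate leaves jw
  -- + k(gw) = 0, so g scales w by -j/k.
  have h2 : (g * w * g⁻¹) ^ k = w ^ (-j) := by
    have e1 : (g ^ n) ^ i * (g * b * g⁻¹) ^ j * (g * (g * b * g⁻¹) * g⁻¹) ^ k = 1 := by
      have : (g ^ n) ^ i * (g * b * g⁻¹) ^ j * (g * (g * b * g⁻¹) * g⁻¹) ^ k =
          g * ((g ^ n) ^ i * b ^ j * (g * b * g⁻¹) ^ k) * g⁻¹ := by
        have hc : Commute ((g ^ n) ^ i) g := ((Commute.refl g).pow_left n).zpow_left i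
        rw [conj_zpow (i := k) (a := g) (b := g * b * g⁻¹), conj_zpow (i := j), ← mul_assoc,
          ← mul_assoc, ← mul_assoc, ← mul_assoc, hc.eq]
        group
      rw [this, h]; group
    have e2 : g * (g * b * g⁻¹) * g⁻¹ = (g * w * g⁻¹) * (g * b * g⁻¹) := by
      calc g * (g * b * g⁻¹) * g⁻¹ = g * (w * b) * g⁻¹ := by rw [hgb]
        _ = (g * w * g⁻¹) * (g * b * g⁻¹) := by group
    rw [e2, (hcomm _ hgwA _ hgbA).mul_zpow] at e1
    have c1 := (hcomm _ (zpow_mem hgwA k) _ (zpow_mem hgbA k)).eq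
    have e3 : (g ^ n) ^ i * b ^ j * (g * b * g⁻¹) ^ k * (w ^ j * (g * w * g⁻¹) ^ k) = 1 := by
      rw [hgb, (hcomm _ hwA _ hb).mul_zpow, ← hgb, c1] at e1
      have c2 := (hcomm _ (mul_mem (mul_mem (zpow_mem hb j) (zpow_mem hgbA k))
        (one_mem A)) _ (zpow_mem hwA j)).eq
      rw [mul_one] at c2
      rw [← e1]
      simp only [mul_assoc] at c2 ⊢
      rw [← mul_assoc (b ^ j), ← mul_assoc (b ^ j * _), mul_assoc (b ^ j), c2]
      simp only [mul_assoc]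
    rw [h, one_mul] at e3
    rw [zpow_neg]
    exact eq_inv_of_mul_eq_one_right e3
  by_cases hw1 : w = 1
  · rw [hw1, one_mul] at hgb
    exact Commute.pow_left (mul_inv_eq_iff_eq_mul.mp hgb) 2
  -- Since g ^ n acts trivially, the ratio -j/k is a root of unity in ℚ, hence ±1.
  have hpow : k ^ n = (-j) ^ n := by
    have e1 := conj_pow_zpow_eq h2 n
    rw [hfix w hwA] at e1
    by_contra hne
    apply hw1
    refine hG w (k ^ n - (-j) ^ n) (sub_ne_zero.mpr hne) ?_
    rw [zpow_sub, e1, mul_inv_cancel]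
  have hk : k ≠ 0 := by
    rintro rfl
    rw [zero_pow hn] at hpow
    have hj : j = 0 := by simpa using pow_eq_zero_iff hn |>.mp hpow.symm
    subst hj
    have hi : i ≠ 0 := by tauto
    exact hgn1 (hG _ i hi (by simpa using h))
  have habs : |k| = |-j| := by
    rw [← pow_left_inj₀ (abs_nonneg k) (abs_nonneg (-j)) hn, ← abs_pow, ← abs_pow, hpow]
  rcases abs_eq_abs.mp habs with hkj | hkj
  -- Eigenvalue 1: g acts unipotently, and g ^ n sends b to w ^ n * b = b, which forces w = 1.
  · exfalso
    rw [← hkj] at h2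
    have e1 := hG.eq_of_zpow_eq (hcomm _ hgwA _ hwA) hk h2
    have e2 := conj_pow_eq_of_conj_eq hgb (mul_inv_eq_iff_eq_mul.mp e1) n
    rw [hfix b hb] at e2
    exact hw1 (hG w n hn' (by rw [zpow_natCast]; exact right_eq_mul.mp e2))
  -- Eigenvalue -1: g sends b to w * b and then to w⁻¹ * w * b = b.
  · rw [neg_neg] at hkj
    rw [← hkj, zpow_neg, ← inv_zpow] at h2
    have e1 := hG.eq_of_zpow_eq (hcomm _ hgwA _ (inv_mem hwA)) hk h2
    have e2 : g ^ 2 * b * (g ^ 2)⁻¹ = g * w * g⁻¹ * (g * b * g⁻¹) := by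
      calc g ^ 2 * b * (g ^ 2)⁻¹ = g * (g * b * g⁻¹) * g⁻¹ := by rw [sq]; group
        _ = g * (w * b) * g⁻¹ := by rw [hgb]
        _ = g * w * g⁻¹ * (g * b * g⁻¹) := by group
    rw [e1, hgb, inv_mul_cancel_left] at e2
    exact mul_inv_eq_iff_eq_mul.mp e2

/-- A torsion-free group that is locally finite modulo an abelian normal subgroup of rank at
most two. -/
theorem IsVirtuallyAbelianRankLETwo.of_isLocallyFiniteIn (hG : IsTorsionFreeGroup G)
    (A : Subgroup G) [hA : A.Normal] (hcomm : ∀ x ∈ A, ∀ y ∈ A, Commute x y)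
    (hdep : ∀ x ∈ A, ∀ y ∈ A, ∀ z ∈ A, ∃ i j k : ℤ, (i ≠ 0 ∨ j ≠ 0 ∨ k ≠ 0) ∧
      x ^ i * y ^ j * z ^ k = 1) (hlf : IsLocallyFiniteIn A ⊤) :
    IsVirtuallyAbelianRankLETwo G := by
  have key : ∀ g : G, ∀ b ∈ A, Commute (g ^ 2) b := by
    intro g b hb
    obtain ⟨n, hn, hgn⟩ := hlf.exists_pow_mem (Subgroup.mem_top g)
    exact commute_sq_of_pow_mem hG A hcomm hdep hn hgn hb
  -- By `key` all squares lie in the centralizer of A, in which A is central with locally finite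
  -- quotient.
  have hC : ∀ x y : G, Commute (x ^ 2) (y ^ 2) := by
    intro x y
    refine commute_of_isLocallyFiniteIn hG (A := A) (C := Subgroup.centralizer A)
      (fun a ha c hc => (Subgroup.mem_centralizer_iff.mp hc a ha))
      (hlf.mono_right le_top) _ ?_ _ ?_
    · exact Subgroup.mem_centralizer_iff.mpr fun b hb => (key x b hb).eq.symm
    · exact Subgroup.mem_centralizer_iff.mpr fun b hb => (key y b hb).eq.symm
  refine ⟨hC, fun x y z => ?_⟩
  obtain ⟨p, hp, hx⟩ := hlf.exists_zpow_mem (Subgroup.mem_top (x ^ 2))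
  obtain ⟨q, hq, hy⟩ := hlf.exists_zpow_mem (Subgroup.mem_top (y ^ 2))
  obtain ⟨r, hr, hz⟩ := hlf.exists_zpow_mem (Subgroup.mem_top (z ^ 2))
  obtain ⟨i, j, k, h0, h⟩ := hdep _ hx _ hy _ hz
  refine ⟨p * i, q * j, r * k,
    h0.imp (mul_ne_zero hp) (Or.imp (mul_ne_zero hq) (mul_ne_zero hr)), ?_⟩
  rw [zpow_mul, zpow_mul, zpow_mul, h]

end Types

/-! ### Independence of the choice of a, and directed unions. -/

section RankOneByRankOne

variable {G : Type u} [Group G]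

/-- This makes G/C(a) torsion-free: t normalizes the rank one group C(a) and fixes its own power
there. -/
theorem IsRankOneByRankOne.commute_of_commute_zpow (hG : IsTorsionFreeGroup G) {a : G}
    (h : IsRankOneByRankOne G a) {t : G} {n : ℤ} (hn : n ≠ 0) (ht : Commute (t ^ n) a) :
    Commute t a :=
  h.rank.commute_of_zpow_mem hG (fun _ hx => mem_centralizer_singleton.mpr
    (h.normal _ t (mem_centralizer_singleton.mp hx))) hn (mem_centralizer_singleton.mpr ht) a
    (mem_centralizer_singleton.mpr (Commute.refl a))

/-- In rank one all nontrivial elements of C(a) have powers in common up to sign and order, so they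
share one centralizer, and a may be replaced by any of them. -/
theorem IsRankOneByRankOne.commute_iff (hG : IsTorsionFreeGroup G) {a : G}
    (h : IsRankOneByRankOne G a) {b : G} (hb : b ≠ 1) (hba : Commute b a) (x : G) :
    Commute x b ↔ Commute x a := by
  have hbC := mem_centralizer_singleton.mpr hba
  have haC := mem_centralizer_singleton.mpr (Commute.refl a)
  refine ⟨fun hx => h.rank.commute_of_commute hG hbC haC
    (mem_centralizer_singleton.mpr (h.normal a x (Commute.refl a))) hb hx, fun hx => ?_⟩
  exact h.rank.comm _ (mem_centralizer_singleton.mpr hx) _ hbC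

theorem IsRankOneByRankOne.of_commute (hG : IsTorsionFreeGroup G) {a : G}
    (h : IsRankOneByRankOne G a) {b : G} (hb : b ≠ 1) (hba : Commute b a) :
    IsRankOneByRankOne G b := by
  have key := h.commute_iff hG hb hba
  have hC : Subgroup.centralizer {b} = Subgroup.centralizer {a} := by
    ext x
    rw [mem_centralizer_singleton, mem_centralizer_singleton, key]
  refine ⟨hb, ?_, hC ▸ h.rank, ?_, ?_⟩
  · simpa only [key] using h.normal
  · simpa only [key] using h.exists_not_commute
  · simpa only [key] using h.dep

theorem IsRankOneByRankOne.of_mulEquiv {H : Type u} [Group H] {a : G}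
    (h : IsRankOneByRankOne G a) (e : G ≃* H) : IsRankOneByRankOne H (e a) := by
  have key : ∀ x : G, Commute (e x) (e a) ↔ Commute x a := fun x =>
    ⟨fun hx => e.injective (by simpa using hx.eq), fun hx => hx.map e⟩
  refine ⟨by simpa using h.ne_one, e.surjective.forall.mpr fun x => e.surjective.forall.mpr
    fun g hx => ?_, ⟨?_, ?_⟩, ?_, ?_⟩
  · rw [← map_inv, ← map_mul, ← map_mul, key]
    exact h.normal x g ((key x).mp hx)
  · refine e.surjective.forall.mpr fun x hx => e.surjective.forall.mpr fun y hy => ?_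
    rw [mem_centralizer_singleton, key] at hx hy
    exact (h.rank.comm x (mem_centralizer_singleton.mpr hx) y
      (mem_centralizer_singleton.mpr hy)).map e
  · refine e.surjective.forall.mpr fun x hx => e.surjective.forall.mpr fun y hy => ?_
    rw [mem_centralizer_singleton, key] at hx hy
    obtain ⟨m, n, hmn, hxy⟩ := h.rank.dep x (mem_centralizer_singleton.mpr hx) y
      (mem_centralizer_singleton.mpr hy)
    exact ⟨m, n, hmn, by rw [← map_zpow, hxy, map_zpow]⟩
  · obtain ⟨t, ht⟩ := h.exists_not_commute
    exact ⟨e t, fun h' => ht ((key t).mp h')⟩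
  · refine e.surjective.forall.mpr fun x => e.surjective.forall.mpr fun y => ?_
    obtain ⟨m, n, hmn, hxy⟩ := h.dep x y
    exact ⟨m, n, hmn, by simpa using (key _).mpr hxy⟩

theorem HasLengthTwoStructure.of_mulEquiv {H : Type u} [Group H]
    (h : HasLengthTwoStructure G) (e : G ≃* H) : HasLengthTwoStructure H := by
  rcases h with h | ⟨a, h⟩
  · exact Or.inl (h.of_injective e.symm.toMonoidHom e.symm.injective)
  · exact Or.inr ⟨e a, h.of_mulEquiv e⟩

/-- The centralizers attached to two such structures, one on a subgroup, are compatible. -/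
theorem IsRankOneByRankOne.commute_map {K : Type u} [Group K] (hK : IsTorsionFreeGroup K)
    (f : G →* K) (hf : Function.Injective f) {a : G} {a' : K} (h : IsRankOneByRankOne G a)
    (h' : IsRankOneByRankOne K a') : Commute (f a) a' := by
  have hG := hK.of_injective f hf
  obtain ⟨t, ht⟩ := h.exists_not_commute
  obtain ⟨m, n, hmn, hc⟩ := h'.dep (f a) (f t)
  set x := a ^ m * t ^ n with hx
  have hfx : Commute (f x) a' := by rw [hx, map_mul, map_zpow, map_zpow]; exact hc
  -- If x were trivial, a nonzero power of t would be a power of a, and t would commute with a; or a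
  -- itself would be torsion.
  have hx1 : x ≠ 1 := by
    intro h1
    rw [hx, mul_eq_one_iff_inv_eq] at h1
    by_cases hn : n = 0
    · rw [hn, zpow_zero, inv_eq_one] at h1
      exact h.ne_one (hG a m (by tauto) h1)
    · refine ht (h.commute_of_commute_zpow hG hn ?_)
      rw [← h1]
      exact ((Commute.refl a).zpow_left m).inv_left
  -- A nontrivial element common to both centralizers: x itself, or its commutator with a, which
  -- lies in both by normality.
  obtain ⟨b, hb1, hba, hfb⟩ : ∃ b : G, b ≠ 1 ∧ Commute b a ∧ Commute (f b) a' := by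
    by_cases hxa : Commute x a
    · exact ⟨x, hx1, hxa, hfx⟩
    · refine ⟨x * a * x⁻¹ * a⁻¹, fun h1 => hxa ?_, ?_, ?_⟩
      · rw [mul_inv_eq_one] at h1
        exact mul_inv_eq_iff_eq_mul.mp h1
      · exact (h.normal a x (Commute.refl a)).mul_left (Commute.refl a).inv_left
      · have h1 : f (x * a * x⁻¹ * a⁻¹) = f x * (f a * f x⁻¹ * (f a)⁻¹) := by
          simp [mul_assoc]
        rw [h1]
        exact hfx.mul_left (h'.normal _ _ (by rw [map_inv]; exact hfx.inv_left))
  have hfb1 : f b ≠ 1 := by rwa [Ne, map_eq_one_iff f hf]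
  exact (h'.commute_iff hK hfb1 hfb (f a)).mp (hba.symm.map f)

/-- Being virtually abelian passes to subgroups. If one member fails it, every larger member is of
the second type, and `commute_map` lets the same a serve in all of them. -/
theorem HasLengthTwoStructure.of_directedUnion (hG : IsTorsionFreeGroup G) (S : Set (Subgroup G))
    (hdir : DirectedOn (· ≤ ·) S) (hcover : ∀ g : G, ∃ K ∈ S, g ∈ K)
    (hS : ∀ K ∈ S, HasLengthTwoStructure K) : HasLengthTwoStructure G := by
  have hcov : ∀ K₀ ∈ S, ∀ x y : G, ∃ K ∈ S, K₀ ≤ K ∧ x ∈ K ∧ y ∈ K := by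
    intro K₀ hK₀ x y
    obtain ⟨K₁, hK₁, hx⟩ := hcover x
    obtain ⟨K₂, hK₂, hy⟩ := hcover y
    obtain ⟨K₃, hK₃, h1, h2⟩ := hdir _ hK₁ _ hK₂
    obtain ⟨K, hK, h3, h4⟩ := hdir _ hK₃ _ hK₀
    exact ⟨K, hK, h4, h3 (h1 hx), h3 (h2 hy)⟩
  by_cases hV : ∀ K ∈ S, IsVirtuallyAbelianRankLETwo K
  · left
    constructor
    · intro x y
      obtain ⟨K₀, hK₀, -⟩ := hcover 1
      obtain ⟨K, hK, -, hx, hy⟩ := hcov K₀ hK₀ x y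
      exact congrArg Subtype.val ((hV K hK).comm ⟨x, hx⟩ ⟨y, hy⟩).eq
    · intro x y z
      obtain ⟨K₀, hK₀, hz⟩ := hcover z
      obtain ⟨K, hK, hle, hx, hy⟩ := hcov K₀ hK₀ x y
      obtain ⟨i, j, k, h0, h⟩ := (hV K hK).dep ⟨x, hx⟩ ⟨y, hy⟩ ⟨z, hle hz⟩
      exact ⟨i, j, k, h0, congrArg Subtype.val h⟩
  · right
    push Not at hV
    obtain ⟨K₀, hK₀, hnV⟩ := hV
    obtain ⟨a, ha⟩ := (hS K₀ hK₀).resolve_left hnV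
    have key : ∀ K ∈ S, ∀ hle : K₀ ≤ K, IsRankOneByRankOne K (Subgroup.inclusion hle a) := by
      intro K hK hle
      have hinj := Subgroup.inclusion_injective hle
      rcases hS K hK with h | ⟨a', ha'⟩
      · exact absurd (h.of_injective _ hinj) hnV
      · exact ha'.of_commute (hG.subgroup K) (by rw [Ne, map_eq_one_iff _ hinj]; exact ha.ne_one)
          (ha.commute_map (hG.subgroup K) _ hinj ha')
    have lift : ∀ {K : Subgroup G} (hle : K₀ ≤ K) {x : G} (hx : x ∈ K),
        Commute x (a : G) ↔ Commute (⟨x, hx⟩ : K) (Subgroup.inclusion hle a) :=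
      fun hle x hx => ⟨fun h => Subtype.ext h.eq, fun h => congrArg Subtype.val h.eq⟩
    refine ⟨a, fun h => ha.ne_one (Subtype.ext h), ?_, ⟨?_, ?_⟩, ?_, ?_⟩
    · intro x g hx
      obtain ⟨K, hK, hle, hxK, hgK⟩ := hcov K₀ hK₀ x g
      exact (lift hle (mul_mem (mul_mem hgK hxK) (inv_mem hgK))).mpr
        ((key K hK hle).normal ⟨x, hxK⟩ ⟨g, hgK⟩ ((lift hle hxK).mp hx))
    · intro x hx y hy
      rw [mem_centralizer_singleton] at hx hy
      obtain ⟨K, hK, hle, hxK, hyK⟩ := hcov K₀ hK₀ x y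
      exact congrArg Subtype.val ((key K hK hle).rank.comm
        ⟨x, hxK⟩ (mem_centralizer_singleton.mpr ((lift hle hxK).mp hx))
        ⟨y, hyK⟩ (mem_centralizer_singleton.mpr ((lift hle hyK).mp hy))).eq
    · intro x hx y hy
      rw [mem_centralizer_singleton] at hx hy
      obtain ⟨K, hK, hle, hxK, hyK⟩ := hcov K₀ hK₀ x y
      obtain ⟨m, n, hmn, h⟩ := (key K hK hle).rank.dep
        ⟨x, hxK⟩ (mem_centralizer_singleton.mpr ((lift hle hxK).mp hx))
        ⟨y, hyK⟩ (mem_centralizer_singleton.mpr ((lift hle hyK).mp hy))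
      exact ⟨m, n, hmn, congrArg Subtype.val h⟩
    · obtain ⟨t, ht⟩ := ha.exists_not_commute
      exact ⟨t, fun h => ht (Subtype.ext h.eq)⟩
    · intro x y
      obtain ⟨K, hK, hle, hxK, hyK⟩ := hcov K₀ hK₀ x y
      obtain ⟨m, n, hmn, h⟩ := (key K hK hle).dep ⟨x, hxK⟩ ⟨y, hyK⟩
      exact ⟨m, n, hmn, (lift hle (mul_mem (zpow_mem hxK m) (zpow_mem hyK n))).mpr h⟩

theorem HasLengthTwoStructure.of_forall_fg (hG : IsTorsionFreeGroup G)
    (h : ∀ H : Subgroup G, H.FG → HasLengthTwoStructure H) : HasLengthTwoStructure G :=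
  .of_directedUnion hG {H | H.FG}
    (fun _ h₁ _ h₂ => ⟨_, Subgroup.FG.sup h₁ h₂, le_sup_left, le_sup_right⟩)
    (fun g => ⟨Subgroup.closure {g}, (Subgroup.fg_iff _).mpr ⟨{g}, rfl, by simp⟩,
      Subgroup.subset_closure rfl⟩) h

end RankOneByRankOne

/-! ### Extensions of a rank one group by a virtually cyclic group. -/

section CyclicExtension

variable {G : Type u} [Group G]

/-- Modulo N both y and z are commensurable with x. The two resulting elements of N are dependent,
and expanding that dependence gives the exponents. -/
theorem exists_dep_of_forall_zpow_notMem {N : Subgroup G} (hN : IsAbelianRankLEOne N) {x y z : G}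
    (hxy : Commute x y) (hxz : Commute x z)
    (h1 : ∃ m n : ℤ, (m ≠ 0 ∨ n ≠ 0) ∧ x ^ m * y ^ n ∈ N)
    (h2 : ∃ m n : ℤ, (m ≠ 0 ∨ n ≠ 0) ∧ x ^ m * z ^ n ∈ N)
    (hx : ∀ m : ℤ, m ≠ 0 → x ^ m ∉ N) :
    ∃ i j k : ℤ, (i ≠ 0 ∨ j ≠ 0 ∨ k ≠ 0) ∧ x ^ i * y ^ j * z ^ k = 1 := by
  obtain ⟨m, n, hmn, h1⟩ := h1
  obtain ⟨m', n', hmn', h2⟩ := h2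
  have hn : n ≠ 0 := by
    rintro rfl
    exact hx m (by tauto) (by simpa using h1)
  have hn' : n' ≠ 0 := by
    rintro rfl
    exact hx m' (by tauto) (by simpa using h2)
  obtain ⟨p, q, hpq, h⟩ := hN.dep _ h1 _ h2
  refine ⟨m * p - m' * q, n * p, -(n' * q), Or.inr (hpq.imp (mul_ne_zero hn)
    fun hq => neg_ne_zero.mpr (mul_ne_zero hn' hq)), ?_⟩
  rw [((hxy.zpow_left m).zpow_right n).mul_zpow, ((hxz.zpow_left m').zpow_right n').mul_zpow,
    ← zpow_mul, ← zpow_mul, ← zpow_mul, ← zpow_mul] at h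
  rw [sub_eq_neg_add, zpow_add, zpow_neg, zpow_neg, mul_assoc _ _ (y ^ _), h]
  group

theorem exists_dep_of_dep_modulo {A N : Subgroup G} (hA : ∀ x ∈ A, ∀ y ∈ A, Commute x y)
    (hN : IsAbelianRankLEOne N)
    (h : ∀ x ∈ A, ∀ y ∈ A, ∃ m n : ℤ, (m ≠ 0 ∨ n ≠ 0) ∧ x ^ m * y ^ n ∈ N) :
    ∀ x ∈ A, ∀ y ∈ A, ∀ z ∈ A, ∃ i j k : ℤ, (i ≠ 0 ∨ j ≠ 0 ∨ k ≠ 0) ∧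
      x ^ i * y ^ j * z ^ k = 1 := by
  intro x hx y hy z hz
  by_cases hxN : ∀ m : ℤ, m ≠ 0 → x ^ m ∉ N
  · exact exists_dep_of_forall_zpow_notMem hN (hA x hx y hy) (hA x hx z hz)
      (h x hx y hy) (h x hx z hz) hxN
  by_cases hyN : ∀ m : ℤ, m ≠ 0 → y ^ m ∉ N
  · obtain ⟨i, j, k, h0, e⟩ := exists_dep_of_forall_zpow_notMem hN (hA y hy x hx) (hA y hy z hz)
      (h y hy x hx) (h y hy z hz) hyN
    exact ⟨j, i, k, by tauto, by rw [← e, ((hA x hx y hy).zpow_left j).zpow_right i]⟩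
  push Not at hxN hyN
  obtain ⟨m, hm, hxm⟩ := hxN
  obtain ⟨n, hn, hyn⟩ := hyN
  obtain ⟨p, q, hpq, e⟩ := hN.dep _ hxm _ hyn
  refine ⟨m * p, -(n * q), 0, hpq.imp (mul_ne_zero hm) fun hq => Or.inl
    (neg_ne_zero.mpr (mul_ne_zero hn hq)), ?_⟩
  rw [zpow_mul, e, zpow_neg, zpow_mul]
  simp

theorem exists_eq_mul_zpow_of_mem_sup {N : Subgroup G} [N.Normal] {t x : G}
    (hx : x ∈ N ⊔ Subgroup.zpowers t) : ∃ c ∈ N, ∃ j : ℤ, x = c * t ^ j := by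
  obtain ⟨c, hc, d, ⟨j, rfl⟩, rfl⟩ := Subgroup.mem_sup_of_normal_left.mp hx
  exact ⟨c, hc, j, rfl⟩

theorem exists_zpow_mul_zpow_mem_of_mem_sup {N : Subgroup G} [hN : N.Normal] {t x y : G}
    (hx : x ∈ N ⊔ Subgroup.zpowers t) (hy : y ∈ N ⊔ Subgroup.zpowers t) :
    ∃ m n : ℤ, (m ≠ 0 ∨ n ≠ 0) ∧ x ^ m * y ^ n ∈ N := by
  obtain ⟨c, hc, i, rfl⟩ := exists_eq_mul_zpow_of_mem_sup hx
  obtain ⟨d, hd, j, rfl⟩ := exists_eq_mul_zpow_of_mem_sup hy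
  by_cases h : i ≠ 0 ∨ j ≠ 0
  -- Modulo N the product becomes t ^ (i * j - j * i).
  · refine ⟨j, -i, by simpa [or_comm] using h, ?_⟩
    rw [← QuotientGroup.eq_one_iff] at hc hd ⊢
    simp only [QuotientGroup.mk_mul, QuotientGroup.mk_zpow, hc, hd, one_mul, ← zpow_mul,
      ← zpow_add]
    rw [show i * j + j * -i = 0 by ring, zpow_zero]
  · push Not at h
    exact ⟨1, 0, by simp, by simpa [h.1] using hc⟩

/-- A torsion-free extension of an abelian group of rank one by a virtually cyclic group. -/
theorem HasLengthTwoStructure.of_virtuallyCyclic_quotient (hG : IsTorsionFreeGroup G)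
    {N : Subgroup G} [hNn : N.Normal] (hN : IsAbelianRankLEOne N) (t : G)
    (hind : (N ⊔ Subgroup.zpowers t).index ≠ 0) : HasLengthTwoStructure G := by
  set C := Subgroup.centralizer (N : Set G) with hC
  have hCn : C.Normal := inferInstance
  have hNC : N ≤ C := fun x hx => Subgroup.mem_centralizer_iff.mpr fun y hy => hN.comm y hy x hx
  have memC : ∀ {x : G}, x ∈ C → ∀ y ∈ N, Commute x y := fun hx y hy =>
    (Subgroup.mem_centralizer_iff.mp hx y hy).symm
  -- If t acts on N with finite order, then C ∩ N⟨t⟩ is abelian of finite index and has rank at most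
  -- two.
  by_cases hk : ∃ k : ℤ, k ≠ 0 ∧ t ^ k ∈ C
  · left
    obtain ⟨k, hk, htk⟩ := hk
    have h1 : C.relIndex (N ⊔ Subgroup.zpowers t) ≠ 0 := by
      have : C.relIndex (N ⊔ Subgroup.zpowers t) = orderOf (QuotientGroup.mk' C t) := by
        conv_lhs => rw [← QuotientGroup.ker_mk' C]
        rw [Subgroup.relIndex_ker, Subgroup.map_sup, MonoidHom.map_zpowers,
          (Subgroup.map_eq_bot_iff N).mpr (by rwa [QuotientGroup.ker_mk']), bot_sup_eq,
          Nat.card_zpowers]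
      rw [this, Ne, orderOf_eq_zero_iff, not_not, isOfFinOrder_iff_zpow_eq_one]
      exact ⟨k, hk, by
        rw [← map_zpow, QuotientGroup.mk'_apply, QuotientGroup.eq_one_iff]; exact htk⟩
    set A := C ⊓ (N ⊔ Subgroup.zpowers t) with hA
    have hAi : A.index ≠ 0 := by
      rw [← Subgroup.relIndex_mul_index (inf_le_right : A ≤ N ⊔ Subgroup.zpowers t),
        Subgroup.inf_relIndex_right]
      exact mul_ne_zero h1 hind
    have hAc : ∀ x ∈ A, ∀ y ∈ A, Commute x y := by
      rintro x ⟨hxC, hx⟩ y ⟨hyC, hy⟩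
      obtain ⟨c, hc, i, rfl⟩ := exists_eq_mul_zpow_of_mem_sup hx
      obtain ⟨d, hd, j, rfl⟩ := exists_eq_mul_zpow_of_mem_sup hy
      have hi : t ^ i ∈ C := (Subgroup.mul_mem_cancel_left _ (hNC hc)).mp hxC
      have hj : t ^ j ∈ C := (Subgroup.mul_mem_cancel_left _ (hNC hd)).mp hyC
      exact ((hN.comm c hc d hd).mul_left (memC hi d hd)).mul_right
        ((memC hj c hc).symm.mul_left (((Commute.refl t).zpow_left i).zpow_right j))
    have hAd := exists_dep_of_dep_modulo hAc hN fun x hx y hy =>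
      exists_zpow_mul_zpow_mem_of_mem_sup hx.2 hy.2
    have : A.FiniteIndex := ⟨hAi⟩
    have hle := A.normalCore_le
    exact .of_isLocallyFiniteIn hG A.normalCore
      (fun x hx y hy => hAc x (hle hx) y (hle hy))
      (fun x hx y hy z hz => hAd x (hle hx) y (hle hy) z (hle hz))
      (.of_index_ne_zero Subgroup.FiniteIndex.index_ne_zero _)
  · right
    push Not at hk
    have ht : t ∉ C := by simpa using hk 1 one_ne_zero
    obtain ⟨a, ha, hat⟩ : ∃ a ∈ N, ¬ Commute t a := by
      by_contra! hcon
      exact ht (Subgroup.mem_centralizer_iff.mpr fun y hy => (hcon y hy).eq.symm)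
    have ha1 : a ≠ 1 := fun h => hat (h ▸ Commute.one_right t)
    have hCa : Subgroup.centralizer {a} = C := by
      ext x
      rw [mem_centralizer_singleton]
      refine ⟨fun h => Subgroup.mem_centralizer_iff.mpr fun y hy => ?_, fun h => memC h a ha⟩
      exact (hN.commute_of_commute hG ha hy (hNn.conj_mem y hy x) ha1 h).eq.symm
    -- No nonzero power of t centralizes N, so C meets the finite index subgroup N⟨t⟩ only in N;
    -- hence C is locally finite over N and has rank one.
    have hCN : C ⊓ (N ⊔ Subgroup.zpowers t) ≤ N := by
      rintro x ⟨hxC, hx⟩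
      obtain ⟨c, hc, i, rfl⟩ := exists_eq_mul_zpow_of_mem_sup hx
      have hi : t ^ i ∈ C := (Subgroup.mul_mem_cancel_left _ (hNC hc)).mp hxC
      have h0 : i = 0 := by
        by_contra h0
        exact hk i h0 hi
      simpa [h0] using hc
    refine ⟨a, ha1, ?_, ?_, ⟨t, hat⟩, ?_⟩
    · intro x g hx
      rw [← mem_centralizer_singleton, hCa] at hx ⊢
      exact hCn.conj_mem x hx g
    · rw [hCa]
      refine hN.of_isLocallyFiniteIn hG (fun g _ a ha => hNn.conj_mem a ha g) ?_
      intro H _ hHC h0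
      refine Subgroup.relIndex_ne_zero_of_index_ne_zero hind H ?_
      rw [← Subgroup.inf_relIndex_right] at h0 ⊢
      refine Nat.eq_zero_of_zero_dvd (h0 ▸ Subgroup.relIndex_dvd_of_le_left H ?_)
      exact le_inf ((le_inf (inf_le_right.trans hHC) inf_le_left).trans hCN) inf_le_right
    · intro g h
      have hlf := IsLocallyFiniteIn.of_index_ne_zero hind ⊤
      obtain ⟨p, hp, hgp⟩ := hlf.exists_zpow_mem (Subgroup.mem_top g)
      obtain ⟨q, hq, hhq⟩ := hlf.exists_zpow_mem (Subgroup.mem_top h)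
      obtain ⟨m, n, hmn, e⟩ := exists_zpow_mul_zpow_mem_of_mem_sup hgp hhq
      refine ⟨p * m, q * n, hmn.imp (mul_ne_zero hp) (mul_ne_zero hq), ?_⟩
      rw [zpow_mul, zpow_mul]
      exact memC (hNC e) a ha

end CyclicExtension

/-! ### Torsion-free extensions with locally finite quotient. -/

section LocallyFiniteQuotient

variable {G : Type u} [Group G]

theorem Subgroup.FG.map_hom {H : Type*} [Group H] {K : Subgroup G} (hK : K.FG) (f : G →* H) :
    (K.map f).FG := by
  obtain ⟨s, rfl, hs⟩ := (Subgroup.fg_iff K).mp hK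
  exact (Subgroup.fg_iff _).mpr ⟨f '' s, (f.map_closure s).symm, hs.image f⟩

theorem finite_of_fg_of_sq_eq_one (H : Type*) [Group H] [Group.FG H] (h : ∀ x : H, x ^ 2 = 1) :
    Finite H := by
  have hc : ∀ a b : H, a * b = b * a := fun a b => by
    have h1 : ∀ x : H, x⁻¹ = x := fun x => inv_eq_of_mul_eq_one_left (by rw [← sq, h])
    have := h1 (a * b)
    rw [mul_inv_rev, h1, h1] at this
    exact this.symm
  let _ : CommGroup H := { (inferInstance : Group H) with mul_comm := hc }
  refine CommGroup.finite_of_fg_isMulTorsion H fun x =>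
    isOfFinOrder_iff_pow_eq_one.mpr ⟨2, two_pos, h x⟩

/-- The subgroup generated by the squares of elements of `N`. -/
def Subgroup.closureSquares (N : Subgroup G) : Subgroup G :=
  Subgroup.closure ((fun x => x ^ 2) '' (N : Set G))

namespace Subgroup

theorem sq_mem_closureSquares {N : Subgroup G} {x : G} (hx : x ∈ N) : x ^ 2 ∈ N.closureSquares :=
  subset_closure ⟨x, hx, rfl⟩

theorem closureSquares_le (N : Subgroup G) : N.closureSquares ≤ N := by
  rw [closureSquares, closure_le]
  rintro _ ⟨x, hx, rfl⟩
  exact pow_mem hx 2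

instance closureSquares_normal (N : Subgroup G) [hN : N.Normal] : N.closureSquares.Normal := by
  refine ⟨fun x hx g => ?_⟩
  rw [closureSquares] at hx
  induction hx using closure_induction with
  | mem x hx =>
    obtain ⟨y, hy, rfl⟩ := hx
    rw [← conj_pow]
    exact sq_mem_closureSquares (hN.conj_mem y hy g)
  | one => simp
  | mul x y _ _ hx hy => simpa [mul_assoc] using mul_mem hx hy
  | inv x _ hx => simpa [mul_assoc] using inv_mem hx

end Subgroup

/-- The intersection N ∩ H is finitely generated, so its image modulo the squares is a finitely
generated group of exponent two, hence finite. The squares thus provide a subgroup that is normal in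
G and loses only a locally finite quotient. -/
theorem isLocallyFiniteIn_closureSquares {N : Subgroup G} [N.Normal]
    (hlf : IsLocallyFiniteIn N ⊤) : IsLocallyFiniteIn N.closureSquares ⊤ := by
  intro H hH _
  have h1 : N.relIndex H ≠ 0 := hlf H hH le_top
  have h2 : (N ⊓ H).relIndex H ≠ 0 := by rwa [Subgroup.inf_relIndex_right]
  refine Subgroup.relIndex_ne_zero_trans (K := N ⊓ H) ?_ h2
  have hfg : (N ⊓ H).FG := by
    have : Group.FG H := (Group.fg_iff_subgroup_fg H).mpr hH
    have : (N.subgroupOf H).FiniteIndex := ⟨h1⟩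
    have h3 : Group.FG (N.subgroupOf H) := inferInstance
    rw [Group.fg_iff_subgroup_fg] at h3
    have := h3.map_hom H.subtype
    rwa [Subgroup.subgroupOf_map_subtype] at this
  set A := N.closureSquares
  rw [← QuotientGroup.ker_mk' A, Subgroup.relIndex_ker]
  have hfg' := hfg.map_hom (QuotientGroup.mk' A)
  rw [← Group.fg_iff_subgroup_fg] at hfg'
  have : Finite ((N ⊓ H).map (QuotientGroup.mk' A)) := by
    refine finite_of_fg_of_sq_eq_one _ ?_
    rintro ⟨_, x, hx, rfl⟩
    refine Subtype.ext ?_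
    change QuotientGroup.mk' A x ^ 2 = 1
    rw [← map_pow, QuotientGroup.mk'_apply, QuotientGroup.eq_one_iff]
    exact Subgroup.sq_mem_closureSquares hx.1
  exact Nat.card_pos.ne'

theorem IsVirtuallyAbelianRankLETwo.commute_closureSquares {N : Subgroup G}
    (h : IsVirtuallyAbelianRankLETwo N) :
    ∀ x ∈ N.closureSquares, ∀ y ∈ N.closureSquares, Commute x y := by
  intro x hx y hy
  induction hx, hy using Subgroup.closure_induction₂ with
  | mem x y hx hy =>
    obtain ⟨x, hx, rfl⟩ := hx
    obtain ⟨y, hy, rfl⟩ := hy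
    exact congrArg Subtype.val (h.comm ⟨x, hx⟩ ⟨y, hy⟩).eq
  | one_left x _ => exact Commute.one_left x
  | one_right x _ => exact Commute.one_right x
  | mul_left x y z _ _ _ h₁ h₂ => exact h₁.mul_left h₂
  | mul_right x y z _ _ _ h₁ h₂ => exact h₁.mul_right h₂
  | inv_left x y _ _ h₁ => exact h₁.inv_left
  | inv_right x y _ _ h₁ => exact h₁.inv_right

theorem IsVirtuallyAbelianRankLETwo.dep_of_mem {N : Subgroup G}
    (h : IsVirtuallyAbelianRankLETwo N) {x y z : G} (hx : x ∈ N) (hy : y ∈ N) (hz : z ∈ N) :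
    ∃ i j k : ℤ, (i ≠ 0 ∨ j ≠ 0 ∨ k ≠ 0) ∧ x ^ i * y ^ j * z ^ k = 1 := by
  obtain ⟨i, j, k, h0, e⟩ := h.dep ⟨x, hx⟩ ⟨y, hy⟩ ⟨z, hz⟩
  refine ⟨2 * i, 2 * j, 2 * k, by omega, ?_⟩
  have := congrArg Subtype.val e
  simpa [zpow_mul] using this

/-- Passing to torsion-free extensions with locally finite quotient. -/
theorem HasLengthTwoStructure.of_isLocallyFiniteIn (hG : IsTorsionFreeGroup G) {N : Subgroup G}
    [hNn : N.Normal] (hN : HasLengthTwoStructure N) (hlf : IsLocallyFiniteIn N ⊤) :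
    HasLengthTwoStructure G := by
  rcases hN with h | ⟨⟨a, haN⟩, h⟩
  · left
    have hle := N.closureSquares_le
    exact .of_isLocallyFiniteIn hG N.closureSquares h.commute_closureSquares
      (fun x hx y hy z hz => h.dep_of_mem (hle hx) (hle hy) (hle hz))
      (isLocallyFiniteIn_closureSquares hlf)
  · right
    -- Conjugation by g is an automorphism of N, and `commute_map` compares the structure at a with
    -- itself along it. This makes A = C(a) ∩ N normal in G.
    have hconj : ∀ g : G, Commute (g * a * g⁻¹) a := fun g =>
      congrArg Subtype.val (h.commute_map (hG.subgroup N) (MulAut.conjNormal g).toMonoidHom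
        (MulAut.conjNormal g).injective h).eq
    have memN : ∀ {x : G} (hx : x ∈ N), Commute x a ↔ Commute (⟨x, hx⟩ : N) ⟨a, haN⟩ :=
      fun hx => ⟨fun h => Subtype.ext h.eq, fun h => congrArg Subtype.val h.eq⟩
    have ha1 : a ≠ 1 := fun h1 => h.ne_one (Subtype.ext h1)
    set A := N ⊓ Subgroup.centralizer {a} with hA
    have hAR : IsAbelianRankLEOne A := by
      constructor
      · rintro x ⟨hx, hxa⟩ y ⟨hy, hya⟩
        replace hxa := (memN hx).mp (mem_centralizer_singleton.mp hxa)
        replace hya := (memN hy).mp (mem_centralizer_singleton.mp hya)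
        exact congrArg Subtype.val (h.rank.comm _ (mem_centralizer_singleton.mpr hxa) _
          (mem_centralizer_singleton.mpr hya)).eq
      · rintro x ⟨hx, hxa⟩ y ⟨hy, hya⟩
        replace hxa := (memN hx).mp (mem_centralizer_singleton.mp hxa)
        replace hya := (memN hy).mp (mem_centralizer_singleton.mp hya)
        obtain ⟨m, n, hmn, e⟩ := h.rank.dep _ (mem_centralizer_singleton.mpr hxa) _
          (mem_centralizer_singleton.mpr hya)
        exact ⟨m, n, hmn, congrArg Subtype.val e⟩
    have haA : a ∈ A := ⟨haN, mem_centralizer_singleton.mpr (Commute.refl a)⟩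
    have hconjA : ∀ g : G, g * a * g⁻¹ ∈ A := fun g =>
      ⟨hNn.conj_mem a haN g, mem_centralizer_singleton.mpr (hconj g)⟩
    have conj_commute : ∀ {x : G} (g : G), Commute x (g⁻¹ * a * g) → Commute (g * x * g⁻¹) a := by
      intro x g hx
      have := hx.map (MulAut.conj g)
      simpa [mul_assoc] using this
    have hAn : ∀ g : G, ∀ x ∈ A, g * x * g⁻¹ ∈ A := by
      intro g x hx
      refine ⟨hNn.conj_mem x hx.1 g, mem_centralizer_singleton.mpr (conj_commute g ?_)⟩
      simpa using hAR.comm x hx _ (hconjA g⁻¹)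
    refine ⟨a, ha1, ?_, ?_, ?_, ?_⟩
    · intro x g hx
      refine conj_commute g ?_
      have hgA : g⁻¹ * a * g ∈ A := by simpa using hconjA g⁻¹
      exact hAR.commute_of_commute hG haA hgA (hAn x _ hgA) ha1 hx
    · refine hAR.of_isLocallyFiniteIn hG (fun g _ => hAn g) ?_
      intro H hH hHC h0
      refine hlf H hH le_top ?_
      rw [← Subgroup.inf_relIndex_right] at h0 ⊢
      refine Nat.eq_zero_of_zero_dvd (h0 ▸ Subgroup.relIndex_dvd_of_le_left H ?_)
      exact le_inf (le_inf inf_le_left (inf_le_right.trans hHC)) inf_le_right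
    · obtain ⟨t, ht⟩ := h.exists_not_commute
      exact ⟨t, fun h' => ht (Subtype.ext h'.eq)⟩
    · intro g k
      obtain ⟨p, hp, hgp⟩ := hlf.exists_zpow_mem (Subgroup.mem_top g)
      obtain ⟨q, hq, hkq⟩ := hlf.exists_zpow_mem (Subgroup.mem_top k)
      obtain ⟨m, n, hmn, e⟩ := h.dep ⟨_, hgp⟩ ⟨_, hkq⟩
      refine ⟨p * m, q * n, hmn.imp (mul_ne_zero hp) (mul_ne_zero hq), ?_⟩
      rw [zpow_mul, zpow_mul]
      exact congrArg Subtype.val e.eq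

end LocallyFiniteQuotient

/-! ### Locally finite groups and the locally finite radical. -/

section LocallyFinite

variable {G : Type u} [Group G]

theorem Subgroup.FG.inf_of_relIndex_ne_zero {N H : Subgroup G} (hH : H.FG)
    (h : N.relIndex H ≠ 0) : (N ⊓ H).FG := by
  have : Group.FG H := (Group.fg_iff_subgroup_fg H).mpr hH
  have : (N.subgroupOf H).FiniteIndex := ⟨h⟩
  have h3 : Group.FG (N.subgroupOf H) := inferInstance
  rw [Group.fg_iff_subgroup_fg] at h3
  simpa only [Subgroup.subgroupOf_map_subtype] using h3.map_hom H.subtype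

theorem Subgroup.FG.subgroupOf {H K : Subgroup G} (hH : H.FG) (hle : H ≤ K) :
    (H.subgroupOf K).FG := by
  rw [← Group.fg_iff_subgroup_fg] at hH ⊢
  exact Group.fg_of_surjective (f := (Subgroup.subgroupOfEquivOfLe hle).symm.toMonoidHom)
    (Subgroup.subgroupOfEquivOfLe hle).symm.surjective

theorem Subgroup.FG.exists_le_of_directedOn {H : Subgroup G} (hH : H.FG) {S : Set (Subgroup G)}
    (hne : S.Nonempty) (hdir : DirectedOn (· ≤ ·) S) (hcover : ∀ g ∈ H, ∃ K ∈ S, g ∈ K) :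
    ∃ K ∈ S, H ≤ K := by
  obtain ⟨s, rfl, hs⟩ := (Subgroup.fg_iff H).mp hH
  suffices h : ∃ K ∈ S, s ⊆ K by simpa only [Subgroup.closure_le] using h
  replace hcover : ∀ g ∈ s, ∃ K ∈ S, g ∈ K := fun g hg => hcover g (Subgroup.subset_closure hg)
  clear hH
  induction s, hs using Set.Finite.induction_on with
  | empty => exact ⟨hne.some, hne.some_mem, Set.empty_subset _⟩
  | insert _ _ ih =>
    obtain ⟨K, hK, h⟩ := ih fun g hg => hcover g (Set.mem_insert_of_mem _ hg)
    obtain ⟨K', hK', h'⟩ := hcover _ (Set.mem_insert _ _)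
    obtain ⟨L, hL, h1, h2⟩ := hdir K hK K' hK'
    exact ⟨L, hL, Set.insert_subset (h2 h') (h.trans h1)⟩

theorem IsLocallyFiniteIn.trans {A B C : Subgroup G} (hAB : IsLocallyFiniteIn A B)
    (hBC : IsLocallyFiniteIn B C) : IsLocallyFiniteIn A C := by
  intro H hH hHC
  have h1 := hBC H hH hHC
  exact Subgroup.relIndex_ne_zero_trans
    (hAB _ (hH.inf_of_relIndex_ne_zero h1) inf_le_left) (by rwa [Subgroup.inf_relIndex_right])

theorem isLocallyFiniteIn_self (A : Subgroup G) : IsLocallyFiniteIn A A := by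
  intro H _ hle
  rw [Subgroup.relIndex_eq_one.mpr hle]
  exact one_ne_zero

theorem isLocallyFiniteIn_bot_iff {C : Subgroup G} :
    IsLocallyFiniteIn ⊥ C ↔ ∀ H : Subgroup G, H.FG → H ≤ C → Finite H := by
  refine forall₃_congr fun H _ _ => ?_
  rw [Subgroup.relIndex_bot_left, Nat.card_ne_zero]
  exact ⟨fun h => h.2, fun h => ⟨inferInstance, h⟩⟩

theorem IsLocallyFiniteIn.comap {Q : Type*} [Group Q] (f : G →* Q) {C : Subgroup Q}
    (h : IsLocallyFiniteIn ⊥ C) : IsLocallyFiniteIn f.ker (C.comap f) := by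
  intro H hH hle
  rw [Subgroup.relIndex_ker, ← Subgroup.relIndex_bot_left]
  exact h _ (hH.map_hom f) (Subgroup.map_le_iff_le_comap.mpr hle)

theorem IsLocallyFiniteIn.map {Q : Type*} [Group Q] (f : G →* Q) {C : Subgroup G}
    (h : IsLocallyFiniteIn ⊥ C) : IsLocallyFiniteIn ⊥ (C.map f) := by
  rw [isLocallyFiniteIn_bot_iff] at h ⊢
  intro H hH hle
  obtain ⟨s, rfl, hs⟩ := (Subgroup.fg_iff H).mp hH
  have hsub : s ⊆ f '' C := fun x hx => hle (Subgroup.subset_closure hx)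
  obtain ⟨t, htC, ht, rfl⟩ := (Set.exists_subset_image_finite_and (p := fun u => u = s)).mp
    ⟨s, hsub, hs, rfl⟩
  have := h (Subgroup.closure t) ((Subgroup.fg_iff _).mpr ⟨t, rfl, ht⟩)
    ((Subgroup.closure_le C).mpr htC)
  rw [← MonoidHom.map_closure]
  exact Set.Finite.image f (Set.toFinite (Subgroup.closure t : Set G))

theorem IsLocallyFiniteIn.sup {A B : Subgroup G} [A.Normal] (hA : IsLocallyFiniteIn ⊥ A)
    (hB : IsLocallyFiniteIn ⊥ B) : IsLocallyFiniteIn ⊥ (A ⊔ B) := by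
  have h := (hB.map (QuotientGroup.mk' A)).comap (QuotientGroup.mk' A)
  rw [QuotientGroup.ker_mk', Subgroup.comap_map_eq, QuotientGroup.ker_mk', sup_comm] at h
  exact hA.trans h

/-- The largest locally finite normal subgroup. -/
def locallyFiniteRadical (G : Type u) [Group G] : Subgroup G :=
  sSup {K | K.Normal ∧ IsLocallyFiniteIn ⊥ K}

/-- Products of two locally finite normal subgroups are again such, so the family is directed and
its supremum is its union. -/
theorem mem_locallyFiniteRadical {x : G} :
    x ∈ locallyFiniteRadical G ↔ ∃ K : Subgroup G, (K.Normal ∧ IsLocallyFiniteIn ⊥ K) ∧ x ∈ K := by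
  refine Subgroup.mem_sSup_of_directedOn (K := {K : Subgroup G | K.Normal ∧ IsLocallyFiniteIn ⊥ K})
    ⟨⊥, inferInstance, isLocallyFiniteIn_self ⊥⟩ ?_
  rintro K ⟨hK, hK'⟩ L ⟨hL, hL'⟩
  exact ⟨K ⊔ L, ⟨inferInstance, hK'.sup hL'⟩, le_sup_left, le_sup_right⟩

theorem isLocallyFiniteIn_locallyFiniteRadical :
    IsLocallyFiniteIn ⊥ (locallyFiniteRadical G) := by
  rw [isLocallyFiniteIn_bot_iff]
  intro H hH hle
  obtain ⟨K, hK, hHK⟩ := hH.exists_le_of_directedOn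
    (S := {K | K.Normal ∧ IsLocallyFiniteIn ⊥ K}) ⟨⊥, inferInstance, isLocallyFiniteIn_self ⊥⟩
    (by
      rintro K ⟨hK, hK'⟩ L ⟨hL, hL'⟩
      exact ⟨K ⊔ L, ⟨inferInstance, hK'.sup hL'⟩, le_sup_left, le_sup_right⟩)
    (fun g hg => mem_locallyFiniteRadical.mp (hle hg))
  exact isLocallyFiniteIn_bot_iff.mp hK.2 H hH hHK

instance : (locallyFiniteRadical G).Characteristic := by
  rw [Subgroup.characteristic_iff_map_le]
  rintro e _ ⟨x, hx, rfl⟩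
  obtain ⟨K, ⟨hK, hK'⟩, hxK⟩ := mem_locallyFiniteRadical.mp hx
  exact mem_locallyFiniteRadical.mpr ⟨K.map e.toMonoidHom,
    ⟨hK.map _ e.surjective, hK'.map _⟩, Subgroup.mem_map_of_mem _ hxK⟩

end LocallyFinite

/-! ### The structure in length at most one, and its use as a quotient. -/

section VirtuallyCyclic

/-- Groups that are virtually cyclic modulo a locally finite normal subgroup. -/
def IsLocallyFiniteByVirtuallyCyclic (G : Type u) [Group G] : Prop :=
  ∃ T : Subgroup G, T.Normal ∧ IsLocallyFiniteIn ⊥ T ∧ ∃ t : G, (T ⊔ Subgroup.zpowers t).index ≠ 0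

/-- Every finitely generated subgroup is virtually cyclic modulo a locally finite normal
subgroup. -/
def HasLengthOneStructure (G : Type u) [Group G] : Prop :=
  ∀ H : Subgroup G, H.FG → IsLocallyFiniteByVirtuallyCyclic H

variable {G : Type u} [Group G]

theorem index_comap_sup_zpowers {Q : Type*} [Group Q] (f : G →* Q) (hf : Function.Surjective f)
    (T : Subgroup Q) (t : G) :
    (T.comap f ⊔ Subgroup.zpowers t).index = (T ⊔ Subgroup.zpowers (f t)).index := by
  have h : f.ker ≤ T.comap f ⊔ Subgroup.zpowers t := le_sup_of_le_left (f.ker_le_comap T)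
  rw [← Subgroup.comap_map_eq_self h, Subgroup.index_comap_of_surjective _ hf, Subgroup.map_sup,
    Subgroup.map_comap_eq_self_of_surjective hf, MonoidHom.map_zpowers]

theorem IsLocallyFiniteByVirtuallyCyclic.of_surjective {Q : Type u} [Group Q]
    (h : IsLocallyFiniteByVirtuallyCyclic Q) (f : G →* Q) (hf : Function.Surjective f)
    (hker : IsLocallyFiniteIn ⊥ f.ker) : IsLocallyFiniteByVirtuallyCyclic G := by
  obtain ⟨T, hT, hT', t, ht⟩ := h
  obtain ⟨t, rfl⟩ := hf t
  exact ⟨T.comap f, hT.comap f, hker.trans (hT'.comap f), t, by rwa [index_comap_sup_zpowers f hf]⟩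

theorem IsLocallyFiniteByVirtuallyCyclic.of_mulEquiv {Q : Type u} [Group Q]
    (h : IsLocallyFiniteByVirtuallyCyclic Q) (e : G ≃* Q) : IsLocallyFiniteByVirtuallyCyclic G := by
  refine h.of_surjective e.toMonoidHom e.surjective ?_
  rw [(MonoidHom.ker_eq_bot_iff _).mpr e.injective]
  exact isLocallyFiniteIn_self ⊥

/-- T is normal only in M. The locally finite radical of M contains T and is characteristic in M,
hence normal in G. -/
theorem IsLocallyFiniteByVirtuallyCyclic.of_index_ne_zero {M : Subgroup G} [M.Normal]
    (hM : M.index ≠ 0) (h : IsLocallyFiniteByVirtuallyCyclic M) :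
    IsLocallyFiniteByVirtuallyCyclic G := by
  obtain ⟨T, hT, hT', t, ht⟩ := h
  refine ⟨(locallyFiniteRadical M).map M.subtype, inferInstance,
    isLocallyFiniteIn_locallyFiniteRadical.map _, t, ?_⟩
  have h1 : (T ⊔ Subgroup.zpowers t).map M.subtype ≤
      (locallyFiniteRadical M).map M.subtype ⊔ Subgroup.zpowers (t : G) := by
    rw [Subgroup.map_sup, MonoidHom.map_zpowers]
    exact sup_le_sup_right (Subgroup.map_mono (fun x hx => mem_locallyFiniteRadical.mpr ⟨T, ⟨hT, hT'⟩, hx⟩)) _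
  have h2 : ((T ⊔ Subgroup.zpowers t).map M.subtype).index ≠ 0 := by
    rw [Subgroup.index_map_subtype]
    exact mul_ne_zero ht hM
  exact fun h0 => h2 (Nat.eq_zero_of_zero_dvd (h0 ▸ Subgroup.index_dvd_of_le h1))

theorem HasLengthOneStructure.of_injective {H : Type u} [Group H] (h : HasLengthOneStructure G)
    (f : H →* G) (hf : Function.Injective f) : HasLengthOneStructure H := fun K hK =>
  (h _ (hK.map_hom f)).of_mulEquiv (K.equivMapOfInjective f hf)

theorem HasLengthOneStructure.of_isLocallyFiniteIn (h : IsLocallyFiniteIn (⊥ : Subgroup G) ⊤) :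
    HasLengthOneStructure G := by
  intro H hH
  refine ⟨⊤, inferInstance, ?_, 1, by simp⟩
  have := h.comap H.subtype
  rwa [Subgroup.comap_top, (MonoidHom.ker_eq_bot_iff _).mpr H.subtype_injective] at this

/-- Torsion-free groups of Hirsch length at most one are abelian of rank at most one. -/
theorem HasLengthOneStructure.isAbelianRankLEOne_top (hG : IsTorsionFreeGroup G)
    (h : HasLengthOneStructure G) : IsAbelianRankLEOne (⊤ : Subgroup G) := by
  have key : ∀ x y : G, Commute x y ∧ ∃ m n : ℤ, (m ≠ 0 ∨ n ≠ 0) ∧ x ^ m = y ^ n := by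
    intro x y
    set H := Subgroup.closure ({x, y} : Set G) with hH
    have hfg : H.FG := (Subgroup.fg_iff H).mpr ⟨{x, y}, rfl, by simp⟩
    have hxH : x ∈ H := Subgroup.subset_closure (by simp)
    have hyH : y ∈ H := Subgroup.subset_closure (by simp)
    have hHtf := hG.subgroup H
    obtain ⟨T, hT, hT', t, ht⟩ := h H hfg
    have hTbot : T = ⊥ := by
      rw [eq_bot_iff]
      intro z hz
      obtain ⟨n, hn, hzn⟩ := hT'.exists_zpow_mem hz
      exact hHtf z n hn hzn
    rw [hTbot, bot_sup_eq] at ht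
    have hcyc : IsAbelianRankLEOne (Subgroup.zpowers t) := by
      constructor
      · rintro _ ⟨i, rfl⟩ _ ⟨j, rfl⟩
        exact ((Commute.refl t).zpow_left i).zpow_right j
      · rintro _ ⟨i, rfl⟩ _ ⟨j, rfl⟩
        by_cases hij : i ≠ 0 ∨ j ≠ 0
        · exact ⟨j, i, hij.symm, by simp only [← zpow_mul, mul_comm]⟩
        · push Not at hij
          exact ⟨1, 1, by simp, by simp [hij]⟩
    have : (Subgroup.zpowers t).FiniteIndex := ⟨ht⟩
    have hR := (hcyc.mono (Subgroup.normalCore_le _)).of_isLocallyFiniteIn hHtf (C := ⊤)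
      (fun g _ a ha => (inferInstance : (Subgroup.zpowers t).normalCore.Normal).conj_mem a ha g)
      (.of_index_ne_zero Subgroup.FiniteIndex.index_ne_zero _)
    refine ⟨congrArg Subtype.val
      (hR.comm ⟨x, hxH⟩ (Subgroup.mem_top _) ⟨y, hyH⟩ (Subgroup.mem_top _)).eq, ?_⟩
    obtain ⟨m, n, hmn, e⟩ := hR.dep ⟨x, hxH⟩ (Subgroup.mem_top _) ⟨y, hyH⟩ (Subgroup.mem_top _)
    exact ⟨m, n, hmn, congrArg Subtype.val e⟩
  exact ⟨fun x _ y _ => (key x y).1, fun x _ y _ => (key x y).2⟩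

/-- A torsion-free extension of an abelian group of rank one by a group that is virtually cyclic
modulo a locally finite normal subgroup. -/
theorem HasLengthTwoStructure.of_surjective {Q : Type*} [Group Q] (hG : IsTorsionFreeGroup G)
    (f : G →* Q) (hf : Function.Surjective f) (hker : IsAbelianRankLEOne f.ker)
    (hQ : IsLocallyFiniteByVirtuallyCyclic Q) : HasLengthTwoStructure G := by
  obtain ⟨T, hT, hT', t, ht⟩ := hQ
  obtain ⟨t, rfl⟩ := hf t
  have hR : IsAbelianRankLEOne (T.comap f) := hker.of_isLocallyFiniteIn hG
    (fun g _ a ha => f.normal_ker.conj_mem a ha g) (hT'.comap f)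
  exact .of_virtuallyCyclic_quotient hG hR t (by rwa [index_comap_sup_zpowers f hf])

/-- The structure of the quotient is known only on finitely generated subgroups, so G is treated as
the directed union of its own. -/
theorem HasLengthTwoStructure.of_extension (hG : IsTorsionFreeGroup G) {N : Subgroup G} [N.Normal]
    (hN : IsAbelianRankLEOne N) (hQ : HasLengthOneStructure (G ⧸ N)) :
    HasLengthTwoStructure G := by
  refine .of_forall_fg hG fun H hH => ?_
  refine .of_surjective (hG.subgroup H) ((QuotientGroup.mk' N).subgroupMap H)
    (MonoidHom.subgroupMap_surjective _ H) ?_ (hQ _ (hH.map_hom _))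
  have hmem : ∀ x : H, x ∈ ((QuotientGroup.mk' N).subgroupMap H).ker → (x : G) ∈ N := by
    intro x hx
    have h1 : QuotientGroup.mk' N x = 1 := congrArg Subtype.val hx
    rwa [QuotientGroup.mk'_apply, QuotientGroup.eq_one_iff] at h1
  refine ⟨fun x hx y hy => Subtype.ext (hN.comm _ (hmem x hx) _ (hmem y hy)).eq,
    fun x hx y hy => ?_⟩
  obtain ⟨m, n, hmn, e⟩ := hN.dep _ (hmem x hx) _ (hmem y hy)
  exact ⟨m, n, hmn, Subtype.ext e⟩

end VirtuallyCyclic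

/-! ### Induction on the Hirsch length. -/

section HirschLength

variable {G : Type u} [Group G]

theorem isLocallyFiniteIn_of_quotient {N : Subgroup G} [N.Normal]
    (h : IsLocallyFiniteIn (⊥ : Subgroup (G ⧸ N)) ⊤) : IsLocallyFiniteIn N ⊤ := by
  have := h.comap (QuotientGroup.mk' N)
  rwa [QuotientGroup.ker_mk', Subgroup.comap_top] at this

theorem isLocallyFiniteIn_bot_of_subgroup {N : Subgroup G}
    (h : IsLocallyFiniteIn (⊥ : Subgroup N) ⊤) : IsLocallyFiniteIn ⊥ N := by
  have := h.map N.subtype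
  rwa [← MonoidHom.range_eq_map, Subgroup.range_subtype] at this

theorem IsTorsionFreeGroup.eq_bot_of_isLocallyFiniteIn (hG : IsTorsionFreeGroup G)
    {N : Subgroup G} (h : IsLocallyFiniteIn ⊥ N) : N = ⊥ := by
  rw [eq_bot_iff]
  intro z hz
  obtain ⟨n, hn, hzn⟩ := h.exists_zpow_mem hz
  exact hG z n hn hzn

theorem HasLengthOneStructure.of_extension {N : Subgroup G} [N.Normal]
    (hN : IsLocallyFiniteIn (⊥ : Subgroup N) ⊤) (hQ : HasLengthOneStructure (G ⧸ N)) :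
    HasLengthOneStructure G := by
  intro H hH
  refine (hQ _ (hH.map_hom (QuotientGroup.mk' N))).of_surjective
    ((QuotientGroup.mk' N).subgroupMap H) (MonoidHom.subgroupMap_surjective _ H) ?_
  have h := (isLocallyFiniteIn_bot_of_subgroup hN).comap H.subtype
  rw [(MonoidHom.ker_eq_bot_iff _).mpr H.subtype_injective] at h
  refine h.mono_right fun x hx => ?_
  have h1 : QuotientGroup.mk' N x = 1 := congrArg Subtype.val hx
  rwa [QuotientGroup.mk'_apply, QuotientGroup.eq_one_iff] at h1

/-- The intersection N ∩ H has finite index in H, hence is finitely generated, and the structure of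
N applies to it. -/
theorem HasLengthOneStructure.of_locallyFinite_quotient {N : Subgroup G} [N.Normal]
    (hN : HasLengthOneStructure N) (hQ : IsLocallyFiniteIn N ⊤) :
    HasLengthOneStructure G := by
  intro H hH
  have h1 : (N.subgroupOf H).index ≠ 0 := hQ H hH le_top
  refine .of_index_ne_zero h1 ?_
  let f : N.subgroupOf H →* N :=
    (H.subtype.comp (N.subgroupOf H).subtype).codRestrict N fun x => x.2
  have hf : Function.Injective f := fun x y hxy =>
    Subtype.ext (Subtype.ext (congrArg (fun z : N => (z : G)) hxy))
  have : Group.FG H := (Group.fg_iff_subgroup_fg H).mpr hH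
  have : (N.subgroupOf H).FiniteIndex := ⟨h1⟩
  have h2 : Group.FG (N.subgroupOf H) := inferInstance
  exact ((hN.of_injective f hf) ⊤ h2.out).of_mulEquiv Subgroup.topEquiv.symm

/-- Three vectors of a module of rank at most two are dependent. -/
theorem exists_dep_of_rank_le_two {M : Type} [AddCommGroup M]
    (hM : Module.rank ℤ M ≤ 2) (x y z : M) :
    ∃ i j k : ℤ, (i ≠ 0 ∨ j ≠ 0 ∨ k ≠ 0) ∧ i • x + j • y + k • z = 0 := by
  have h : ¬ LinearIndependent ℤ ![x, y, z] := by
    intro h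
    have h1 := h.cardinal_le_rank.trans hM
    rw [Cardinal.mk_fin] at h1
    norm_cast at h1
  obtain ⟨g, hg, i, hi⟩ := Fintype.not_linearIndependent_iff.mp h
  refine ⟨g 0, g 1, g 2, ?_, by simpa [Fin.sum_univ_three] using hg⟩
  fin_cases i
  · exact Or.inl hi
  · exact Or.inr (Or.inl hi)
  · exact Or.inr (Or.inr hi)

theorem isLocallyFiniteIn_bot_of_virtuallyTrivial {A : Subgroup G} (hA : A.FiniteIndex)
    (e : A ≃* Multiplicative (Fin 0 → ℤ)) : IsLocallyFiniteIn (⊥ : Subgroup G) ⊤ := by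
  have : Subsingleton (Multiplicative (Fin 0 → ℤ)) := inferInstanceAs (Subsingleton (Fin 0 → ℤ))
  have : Subsingleton A := e.injective.subsingleton
  rw [← A.eq_bot_of_subsingleton]
  exact .of_index_ne_zero hA.index_ne_zero _

theorem HasLengthOneStructure.of_virtuallyFreeAbelian {A : Subgroup G} (hA : A.FiniteIndex) {n : ℕ}
    (hn : n ≤ 1) (e : A ≃* Multiplicative (Fin n → ℤ)) : HasLengthOneStructure G := by
  obtain rfl | rfl : n = 0 ∨ n = 1 := by omega
  · exact .of_isLocallyFiniteIn (isLocallyFiniteIn_bot_of_virtuallyTrivial hA e)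
  · intro H _
    have e' : A ≃* Multiplicative ℤ :=
      e.trans (AddEquiv.toMultiplicative (LinearEquiv.funUnique (Fin 1) ℤ ℤ).toAddEquiv)
    let f : A.subgroupOf H →* A :=
      (H.subtype.comp (A.subgroupOf H).subtype).codRestrict A fun x => x.2
    have hf : Function.Injective f := fun x y hxy =>
      Subtype.ext (Subtype.ext (congrArg (fun z : A => (z : G)) hxy))
    have hcyc : IsCyclic (A.subgroupOf H) :=
      isCyclic_of_injective (e'.toMonoidHom.comp f) (e'.injective.comp hf)
    obtain ⟨t, ht⟩ := (Subgroup.isCyclic_iff_exists_zpowers_eq_top _).mp hcyc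
    refine ⟨⊥, inferInstance, isLocallyFiniteIn_self ⊥, t, ?_⟩
    rw [bot_sup_eq, ht]
    exact Subgroup.relIndex_ne_zero_of_index_ne_zero hA.index_ne_zero H

theorem IsVirtuallyAbelianRankLETwo.of_virtuallyFreeAbelian (hG : IsTorsionFreeGroup G)
    {A : Subgroup G} (hA : A.FiniteIndex) {n : ℕ} (hn : n ≤ 2)
    (e : A ≃* Multiplicative (Fin n → ℤ)) : IsVirtuallyAbelianRankLETwo G := by
  have hc : ∀ x ∈ A, ∀ y ∈ A, Commute x y := fun x hx y hy =>
    congrArg Subtype.val (e.injective (by rw [map_mul, map_mul, mul_comm]) :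
      (⟨x, hx⟩ : A) * ⟨y, hy⟩ = ⟨y, hy⟩ * ⟨x, hx⟩)
  have hd : ∀ x ∈ A, ∀ y ∈ A, ∀ z ∈ A, ∃ i j k : ℤ, (i ≠ 0 ∨ j ≠ 0 ∨ k ≠ 0) ∧
      x ^ i * y ^ j * z ^ k = 1 := by
    intro x hx y hy z hz
    obtain ⟨i, j, k, h0, h⟩ := exists_dep_of_rank_le_two (M := Fin n → ℤ)
      (by rw [rank_fun']; simpa using hn) (e ⟨x, hx⟩).toAdd (e ⟨y, hy⟩).toAdd (e ⟨z, hz⟩).toAdd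
    refine ⟨i, j, k, h0, ?_⟩
    have h1 : e (⟨x, hx⟩ ^ i * ⟨y, hy⟩ ^ j * ⟨z, hz⟩ ^ k) = e 1 := by
      rw [map_mul, map_mul, map_zpow, map_zpow, map_zpow, map_one]
      exact h
    exact congrArg Subtype.val (e.injective h1)
  have hle := A.normalCore_le
  exact .of_isLocallyFiniteIn hG A.normalCore (fun x hx y hy => hc x (hle hx) y (hle hy))
    (fun x hx y hy z hz => hd x (hle hx) y (hle hy) z (hle hz))
    (.of_index_ne_zero Subgroup.FiniteIndex.index_ne_zero _)

/-- The structure of groups of Hirsch length at most two. -/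
theorem HasHirschLength.structure {G : Type u} [Group G] {n : ℕ∞} (h : HasHirschLength G n) :
    (n = 0 → IsLocallyFiniteIn (⊥ : Subgroup G) ⊤) ∧ (n ≤ 1 → HasLengthOneStructure G) ∧
      (n ≤ 2 → IsTorsionFreeGroup G → HasLengthTwoStructure G) := by
  -- Torsion-freeness is required only in the third clause, because the quotient in an extension may
  -- have torsion; there the first two clauses are used.
  induction h with
  | of_virtuallyFreeAbelian G A hA n e =>
    refine ⟨fun hn => ?_, fun hn => ?_, fun hn htf => ?_⟩
    · obtain rfl : n = 0 := by exact_mod_cast hn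
      exact isLocallyFiniteIn_bot_of_virtuallyTrivial hA e
    · exact .of_virtuallyFreeAbelian hA (by exact_mod_cast hn) e
    · exact Or.inl (.of_virtuallyFreeAbelian htf hA (by exact_mod_cast hn) e)
  | of_extension G N m n hN hQ ihN ihQ =>
    refine ⟨fun hn => ?_, fun hn => ?_, fun hn htf => ?_⟩
    · rw [add_eq_zero] at hn
      exact (isLocallyFiniteIn_bot_of_subgroup (ihN.1 hn.1)).trans
        (isLocallyFiniteIn_of_quotient (ihQ.1 hn.2))
    · have hcases : (m = 0 ∧ n ≤ 1) ∨ (m ≤ 1 ∧ n = 0) := by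
        lift m to ℕ using by rintro rfl; simp at hn
        lift n to ℕ using by rintro rfl; simp at hn
        norm_cast at hn ⊢
        omega
      rcases hcases with ⟨hm, hn⟩ | ⟨hm, hn⟩
      · exact .of_extension (ihN.1 hm) (ihQ.2.1 hn)
      · exact .of_locallyFinite_quotient (ihN.2.1 hm) (isLocallyFiniteIn_of_quotient (ihQ.1 hn))
    · have hcases : (m = 0 ∧ n ≤ 2) ∨ (m ≤ 1 ∧ n ≤ 1) ∨ (m ≤ 2 ∧ n = 0) := by
        lift m to ℕ using by rintro rfl; simp at hn
        lift n to ℕ using by rintro rfl; simp at hn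
        norm_cast at hn ⊢
        omega
      rcases hcases with ⟨hm, hn⟩ | ⟨hm, hn⟩ | ⟨hm, hn⟩
      -- A locally finite subgroup of a torsion-free group is trivial.
      · obtain rfl := htf.eq_bot_of_isLocallyFiniteIn
          (isLocallyFiniteIn_bot_of_subgroup (ihN.1 hm))
        have e : G ⧸ (⊥ : Subgroup G) ≃* G := QuotientGroup.quotientBot
        exact (ihQ.2.2 hn (htf.of_injective e.toMonoidHom e.injective)).of_mulEquiv e
      · have h1 := (ihN.2.1 hm).isAbelianRankLEOne_top (htf.subgroup N)
        have h2 : IsAbelianRankLEOne N := by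
          refine ⟨fun x hx y hy => congrArg Subtype.val
            (h1.comm ⟨x, hx⟩ (Subgroup.mem_top _) ⟨y, hy⟩ (Subgroup.mem_top _)).eq,
            fun x hx y hy => ?_⟩
          obtain ⟨i, j, hij, e⟩ :=
            h1.dep ⟨x, hx⟩ (Subgroup.mem_top _) ⟨y, hy⟩ (Subgroup.mem_top _)
          exact ⟨i, j, hij, congrArg Subtype.val e⟩
        exact .of_extension htf h2 (ihQ.2.1 hn)
      · exact .of_isLocallyFiniteIn htf (ihN.2.2 hm (htf.subgroup N))
          (isLocallyFiniteIn_of_quotient (ihQ.1 hn))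
  | of_directedUnion G S hdir hcover h hS ih =>
    have hle : ∀ K ∈ S, h K ≤ ⨆ K ∈ S, h K := fun K hK => le_iSup₂ (f := fun K _ => h K) K hK
    have hne : S.Nonempty := (hcover 1).imp fun K hK => hK.1
    refine ⟨fun hn => ?_, fun hn => ?_, fun hn htf => ?_⟩
    · rw [isLocallyFiniteIn_bot_iff]
      intro H hH _
      obtain ⟨K, hK, hHK⟩ := hH.exists_le_of_directedOn hne hdir fun g _ => hcover g
      exact isLocallyFiniteIn_bot_iff.mp (isLocallyFiniteIn_bot_of_subgroup
        ((ih K hK).1 (le_antisymm (hn ▸ hle K hK) bot_le))) H hH hHK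
    · intro H hH
      obtain ⟨K, hK, hHK⟩ := hH.exists_le_of_directedOn hne hdir fun g _ => hcover g
      exact ((ih K hK).2.1 ((hle K hK).trans hn) _ (hH.subgroupOf hHK)).of_mulEquiv
        (Subgroup.subgroupOfEquivOfLe hHK).symm
    · exact .of_directedUnion htf S hdir hcover fun K hK =>
        (ih K hK).2.2 ((hle K hK).trans hn) (htf.subgroup K)

/-- Groups in which any two elements are dependent have Hirsch length at most one, and torsion
groups have Hirsch length zero. -/
theorem HasHirschLength.le_one_of_dep {G : Type u} [Group G] {n : ℕ∞} (h : HasHirschLength G n) :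
    ((∀ x : G, IsOfFinOrder x) → n = 0) ∧
      ((∀ x y : G, ∃ i j : ℤ, (i ≠ 0 ∨ j ≠ 0) ∧ x ^ i = y ^ j) → n ≤ 1) := by
  induction h with
  | of_virtuallyFreeAbelian G A hA n e =>
    refine ⟨fun ht => ?_, fun hd => ?_⟩
    · by_contra hn
      have hn : 0 < n := Nat.pos_of_ne_zero (by exact_mod_cast hn)
      set v : Multiplicative (Fin n → ℤ) := Multiplicative.ofAdd fun _ => 1
      have h1 : IsOfFinOrder (e.symm v) := by
        rw [← Submonoid.isOfFinOrder_coe]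
        exact ht _
      have h2 := e.toMonoidHom.isOfFinOrder h1
      rw [MulEquiv.toMonoidHom_eq_coe, MonoidHom.coe_coe, MulEquiv.apply_symm_apply] at h2
      obtain ⟨k, hk, hv⟩ := isOfFinOrder_iff_pow_eq_one.mp h2
      have h3 := congrFun (congrArg Multiplicative.toAdd hv) ⟨0, hn⟩
      simp [v] at h3
      omega
    · by_contra hn
      have hn : 1 < n := by
        rw [not_le] at hn
        exact_mod_cast hn
      let v : Fin n → A := fun i => e.symm (Multiplicative.ofAdd (Pi.single i 1))
      obtain ⟨i, j, hij, h⟩ := hd (v ⟨0, by omega⟩) (v ⟨1, hn⟩)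
      have h1 : v ⟨0, by omega⟩ ^ i = v ⟨1, hn⟩ ^ j := Subtype.ext h
      have h2 := congrArg (fun x => (e x).toAdd) h1
      simp only [v, map_zpow, MulEquiv.apply_symm_apply, toAdd_zpow, toAdd_ofAdd] at h2
      have h3 := congrFun h2 ⟨0, by omega⟩
      have h4 := congrFun h2 ⟨1, hn⟩
      simp at h3 h4
      omega
  | of_extension G N m n hN hQ ihN ihQ =>
    have torQ : (∀ x : G, ∃ k : ℤ, k ≠ 0 ∧ x ^ k ∈ N) → n = 0 := by
      refine fun h => ihQ.1 fun x => ?_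
      obtain ⟨x, rfl⟩ := QuotientGroup.mk_surjective x
      obtain ⟨k, hk, hx⟩ := h x
      refine isOfFinOrder_iff_zpow_eq_one.mpr ⟨k, hk, ?_⟩
      rwa [← QuotientGroup.mk_zpow, QuotientGroup.eq_one_iff]
    refine ⟨fun ht => ?_, fun hd => ?_⟩
    · rw [ihN.1 fun x => Submonoid.isOfFinOrder_coe.mp (ht x), zero_add]
      refine torQ fun x => ?_
      obtain ⟨k, hk, hx⟩ := isOfFinOrder_iff_zpow_eq_one.mp (ht x)
      exact ⟨k, hk, hx ▸ one_mem N⟩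
    · by_cases hN : ∀ x : N, IsOfFinOrder x
      · rw [ihN.1 hN, zero_add]
        refine ihQ.2 fun x y => ?_
        obtain ⟨x, rfl⟩ := QuotientGroup.mk_surjective x
        obtain ⟨y, rfl⟩ := QuotientGroup.mk_surjective y
        obtain ⟨i, j, hij, h⟩ := hd x y
        exact ⟨i, j, hij, by rw [← QuotientGroup.mk_zpow, h, QuotientGroup.mk_zpow]⟩
      -- If N has an element x of infinite order, every element of G has a nonzero power in ⟨x⟩, so
      -- the quotient is torsion.
      · push Not at hN
        obtain ⟨x, hx⟩ := hN
        rw [torQ, add_zero]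
        · refine ihN.2 fun y z => ?_
          obtain ⟨i, j, hij, h⟩ := hd y z
          exact ⟨i, j, hij, Subtype.ext h⟩
        · intro y
          obtain ⟨i, j, hij, h⟩ := hd x y
          refine ⟨j, ?_, h ▸ zpow_mem x.2 i⟩
          rintro rfl
          refine hx (isOfFinOrder_iff_zpow_eq_one.mpr ⟨i, by tauto, Subtype.ext ?_⟩)
          simpa using h
  | of_directedUnion G S hdir hcover h hS ih =>
    refine ⟨fun ht => ?_, fun hd => ?_⟩
    · refine le_antisymm (iSup₂_le fun K hK => ?_) bot_le
      exact ((ih K hK).1 fun x => Submonoid.isOfFinOrder_coe.mp (ht x)).le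
    · refine iSup₂_le fun K hK => (ih K hK).2 fun y z => ?_
      obtain ⟨i, j, hij, h⟩ := hd y z
      exact ⟨i, j, hij, Subtype.ext h⟩

end HirschLength

/-! ### Computing the Hirsch–Plotkin radical. -/

section Radical

open scoped commutatorElement

variable {G : Type u} [Group G]

/-- An element of a locally nilpotent normal subgroup acts unipotently: iterated commutators with
it cannot stay away from the identity. -/
theorem IsLocallyNilpotent.false_of_commutator_mem {N : Subgroup G} [hNn : N.Normal]
    (hN : IsLocallyNilpotent N) {x : G} (hx : x ∈ N) (S : Set G) (hS : S.Nonempty)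
    (hS1 : 1 ∉ S) (hSc : ∀ c ∈ S, ⁅x, c⁆ ∈ S) : False := by
  obtain ⟨c, hc⟩ := hS
  -- The element c need not lie in N, but its commutator with x does, so the iteration starts there.
  have hb : ⁅x, c⁆ ∈ N := by
    rw [commutatorElement_def, mul_assoc, mul_assoc, ← mul_assoc c]
    exact mul_mem hx (hNn.conj_mem _ (inv_mem hx) c)
  set H := Subgroup.closure ({⟨x, hx⟩, ⟨⁅x, c⁆, hb⟩} : Set N) with hH
  have hnil := hN H ((Subgroup.fg_iff H).mpr ⟨_, rfl, by simp⟩)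
  have hxH : (⟨x, hx⟩ : N) ∈ H := Subgroup.subset_closure (by simp)
  obtain ⟨n, hn⟩ := Subgroup.nilpotent_iff_lowerCentralSeries.mp hnil
  -- Iterated commutators with x descend the lower central series of H while staying in S.
  have key : ∀ k : ℕ, ∃ z : H, z ∈ (⊤ : Subgroup H).lowerCentralSeries k ∧ ((z : N) : G) ∈ S := by
    intro k
    induction k with
    | zero =>
      exact ⟨⟨⟨_, hb⟩, Subgroup.subset_closure (by simp)⟩, Subgroup.mem_top _, hSc c hc⟩
    | succ k ih =>
      obtain ⟨z, hz, hzS⟩ := ih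
      refine ⟨⁅(⟨_, hxH⟩ : H), z⁆, ?_, hSc _ hzS⟩
      rw [← commutatorElement_inv]
      exact inv_mem (Subgroup.commutator_mem_commutator hz (Subgroup.mem_top _))
  obtain ⟨z, hz, hzS⟩ := key n
  rw [hn, Subgroup.mem_bot] at hz
  rw [hz] at hzS
  exact hS1 hzS

theorem hirschPlotkinRadical_eq {C : Subgroup G} [hCn : C.Normal]
    (hC : ∀ x ∈ C, ∀ y ∈ C, Commute x y)
    (h : ∀ N : Subgroup G, N.Normal → IsLocallyNilpotent N → N ≤ C) :
    hirschPlotkinRadical G = C := by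
  refine le_antisymm (sSup_le fun N hN => h N hN.1 hN.2) (le_sSup ⟨hCn, fun K _ => ?_⟩)
  have hK : ∀ a b : K, a * b = b * a := fun a b =>
    Subtype.ext (Subtype.ext (hC _ a.1.2 _ b.1.2).eq)
  let _ : CommGroup K := { (inferInstance : Group K) with mul_comm := hK }
  exact CommGroup.isNilpotent

/-- If x does not commute with a, it commutes with no nontrivial element of C(a), so commutation
with x preserves the nontrivial elements of C(a). -/
theorem IsRankOneByRankOne.hirschPlotkinRadical_eq (hG : IsTorsionFreeGroup G) {a : G}
    (h : IsRankOneByRankOne G a) : hirschPlotkinRadical G = Subgroup.centralizer {a} := by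
  have : (Subgroup.centralizer {a}).Normal := ⟨fun x hx g =>
    mem_centralizer_singleton.mpr (h.normal x g (mem_centralizer_singleton.mp hx))⟩
  refine _root_.hirschPlotkinRadical_eq h.rank.comm fun N hNn hN x hx => ?_
  rw [mem_centralizer_singleton]
  by_contra hxa
  refine hN.false_of_commutator_mem hx {c | Commute c a ∧ c ≠ 1} ⟨a, Commute.refl a, h.ne_one⟩
    (by simp) ?_
  rintro c ⟨hc, hc1⟩
  refine ⟨(h.normal c x hc).mul_left hc.inv_left, fun h1 => hxa ?_⟩
  rw [commutatorElement_eq_one_iff_commute] at h1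
  exact (h.commute_iff hG hc1 hc x).mp h1

end Radical

/-! ### The virtually abelian case: radical and index. -/

section VirtuallyAbelian

open scoped commutatorElement

variable {G : Type u} [Group G]

/-- The centralizer of the subgroup generated by the squares. -/
def centralizerSquares (G : Type u) [Group G] : Subgroup G :=
  Subgroup.centralizer ((⊤ : Subgroup G).closureSquares : Set G)

instance : (centralizerSquares G).Normal :=
  inferInstanceAs (Subgroup.centralizer ((⊤ : Subgroup G).closureSquares : Set G)).Normal

theorem mem_centralizerSquares {x : G} :
    x ∈ centralizerSquares G ↔ ∀ s ∈ (⊤ : Subgroup G).closureSquares, Commute x s :=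
  Subgroup.mem_centralizer_iff.trans
    ⟨fun h s hs => (h s hs).symm, fun h s hs => (h s hs).symm⟩

namespace IsVirtuallyAbelianRankLETwo

theorem commute_squares (h : IsVirtuallyAbelianRankLETwo G) : ∀ x ∈ (⊤ : Subgroup G).closureSquares,
    ∀ y ∈ (⊤ : Subgroup G).closureSquares, Commute x y :=
  (h.of_injective (⊤ : Subgroup G).subtype (Subgroup.subtype_injective _)).commute_closureSquares

theorem sq_mem_centralizerSquares (h : IsVirtuallyAbelianRankLETwo G) (x : G) : x ^ 2 ∈ centralizerSquares G :=
  mem_centralizerSquares.mpr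
    (h.commute_squares _ (Subgroup.sq_mem_closureSquares (Subgroup.mem_top x)))

theorem _root_.IsTorsionFreeGroup.commute_centralizerSquares (hG : IsTorsionFreeGroup G) :
    ∀ x ∈ centralizerSquares G, ∀ y ∈ centralizerSquares G, Commute x y :=
  commute_of_isLocallyFiniteIn hG (A := (⊤ : Subgroup G).closureSquares)
    (fun s hs _ hc => (mem_centralizerSquares.mp hc s hs).symm)
    ((isLocallyFiniteIn_closureSquares (isLocallyFiniteIn_self ⊤)).mono_right le_top)

theorem dep' (h : IsVirtuallyAbelianRankLETwo G) (x y z : G) : ∃ i j k : ℤ, (i ≠ 0 ∨ j ≠ 0 ∨ k ≠ 0) ∧ x ^ i * y ^ j * z ^ k = 1 :=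
  (h.of_injective (⊤ : Subgroup G).subtype (Subgroup.subtype_injective _)).dep_of_mem
    (Subgroup.mem_top x) (Subgroup.mem_top y) (Subgroup.mem_top z)

/-- Since x² centralizes the squares, x acts on them as an involution, and (x - 1)s lies in its -1
eigenspace. -/
theorem exists_inverted (h : IsVirtuallyAbelianRankLETwo G) {x : G} (hx : x ∉ centralizerSquares G) :
    ∃ w ∈ (⊤ : Subgroup G).closureSquares, w ≠ 1 ∧ x * w * x⁻¹ = w⁻¹ := by
  rw [mem_centralizerSquares] at hx
  push Not at hx
  obtain ⟨s, hs, hxs⟩ := hx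
  have hn := Subgroup.closureSquares_normal (⊤ : Subgroup G)
  refine ⟨x * s * x⁻¹ * s⁻¹, mul_mem (hn.conj_mem s hs x) (inv_mem hs), fun h1 => hxs ?_, ?_⟩
  · rw [mul_inv_eq_one] at h1
    exact mul_inv_eq_iff_eq_mul.mp h1
  · have h2 := mem_centralizerSquares.mp (h.sq_mem_centralizerSquares x) s hs
    calc x * (x * s * x⁻¹ * s⁻¹) * x⁻¹ = (x ^ 2 * s) * (x⁻¹ * s⁻¹ * x⁻¹) := by
          rw [sq]; simp only [mul_assoc]
      _ = s * x ^ 2 * (x⁻¹ * s⁻¹ * x⁻¹) := by rw [h2.eq]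
      _ = (x * s * x⁻¹ * s⁻¹)⁻¹ := by rw [sq]; simp [mul_assoc]

/-- If x inverts c, then ⁅x, c⁆ = c ^ (-2), which is again nontrivial and inverted by x. -/
theorem hirschPlotkinRadical_eq (h : IsVirtuallyAbelianRankLETwo G) (hG : IsTorsionFreeGroup G) :
    hirschPlotkinRadical G = centralizerSquares G := by
  refine _root_.hirschPlotkinRadical_eq (hG.commute_centralizerSquares) fun N hNn hN x hx => ?_
  by_contra hxC
  obtain ⟨w, hw, hw1, hxw⟩ := h.exists_inverted hxC
  refine hN.false_of_commutator_mem hx {c | c ≠ 1 ∧ x * c * x⁻¹ = c⁻¹} ⟨w, hw1, hxw⟩ (by simp) ?_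
  rintro c ⟨hc1, hc⟩
  have h1 : ⁅x, c⁆ = c ^ (-2 : ℤ) := by
    rw [commutatorElement_def, hc]; group
  rw [h1]
  exact ⟨fun h2 => hc1 (hG c _ (by norm_num) h2), by rw [← conj_zpow, hc, inv_zpow]⟩

/-- An involution of a torsion-free abelian group acts by a sign on an eigenline. -/
theorem _root_.eq_or_eq_inv_of_dep (hG : IsTorsionFreeGroup G) {y d : G} (hd : d ≠ 1)
    (hc : Commute (y * d * y⁻¹) d) (hy : Commute (y ^ 2) d) {i j : ℤ} (hij : i ≠ 0 ∨ j ≠ 0)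
    (e : d ^ i * (y * d * y⁻¹) ^ j = 1) : y * d * y⁻¹ = d ∨ y * d * y⁻¹ = d⁻¹ := by
  set d' := y * d * y⁻¹ with hd'
  have hyd' : y * d' * y⁻¹ = d := by
    calc y * d' * y⁻¹ = y ^ 2 * d * (y ^ 2)⁻¹ := by rw [hd', sq]; group
      _ = d := by rw [hy.eq, mul_inv_cancel_right]
  have e' : d' ^ i * d ^ j = 1 := by
    have : y * (d ^ i * d' ^ j) * y⁻¹ = 1 := by rw [e]; group
    rwa [← conj_mul, ← conj_zpow, ← conj_zpow, hyd', ← hd'] at this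
  have h1 : d' ^ j = d ^ (-i) := by rw [zpow_neg]; exact eq_inv_of_mul_eq_one_right e
  have h2 : d' ^ i = d ^ (-j) := by rw [zpow_neg]; exact eq_inv_of_mul_eq_one_left e'
  -- Conjugation by y swaps d and d'. The relation and its conjugate together give i² = j².
  have h3 : (-i) * i = (-j) * j := by
    have h4 : d ^ ((-i) * i) = d ^ ((-j) * j) := by
      rw [zpow_mul, ← h1, zpow_mul, ← h2, zpow_comm]
    by_contra hne
    exact hd (hG d _ (sub_ne_zero.mpr hne) (by rw [zpow_sub, h4, mul_inv_cancel]))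
  rcases mul_self_eq_mul_self_iff.mp (show i * i = j * j by linarith) with h4 | h4
  · right
    have hi : i ≠ 0 := by rcases hij with h | h <;> [exact h; exact h4 ▸ h]
    refine hG.eq_of_zpow_eq hc.inv_right hi ?_
    rw [h2, h4, zpow_neg, inv_zpow]
  · left
    have hi : i ≠ 0 := by rcases hij with h | h <;> [exact h; omega]
    refine hG.eq_of_zpow_eq hc hi ?_
    rw [h2, h4]

/-- In the rational basis c = x² and w, x acts as diag(1, -1). The action of y commutes with it, so
y is diagonal with signs; -1 cannot occur for y or for y * x, and the identity is excluded for y, so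
y acts as x does. -/
theorem mul_mem_of_notMem (h : IsVirtuallyAbelianRankLETwo G) (hG : IsTorsionFreeGroup G) {x y : G} (hx : x ∉ centralizerSquares G)
    (hy : y ∉ centralizerSquares G) : y * x ∈ centralizerSquares G := by
  set B := (⊤ : Subgroup G).closureSquares with hB
  have hBn : B.Normal := Subgroup.closureSquares_normal _
  have hcomm := h.commute_squares
  have hsq : ∀ g : G, ∀ s ∈ B, Commute (g ^ 2) s := fun g =>
    mem_centralizerSquares.mp (h.sq_mem_centralizerSquares g)
  have hsqB : ∀ g : G, g ^ 2 ∈ B := fun g =>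
    Subgroup.sq_mem_closureSquares (Subgroup.mem_top g)
  have hx1 : x ≠ 1 := fun h1 => hx (h1 ▸ one_mem _)
  obtain ⟨w, hw, hw1, hxw⟩ := h.exists_inverted hx
  set c := x ^ 2 with hc
  have hcB : c ∈ B := hsqB x
  have hc1 : c ≠ 1 := fun h1 => hx1 (hG x 2 two_ne_zero (by exact_mod_cast h1))
  have hxc : x * c * x⁻¹ = c := by rw [hc]; group
  by_contra hg
  -- The squares of x, y and x * y all act trivially on B, so the actions of x and y commute.
  have hcommYX : ∀ s ∈ B, x * (y * s * y⁻¹) * x⁻¹ = y * (x * s * x⁻¹) * y⁻¹ := by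
    intro s hs
    have h1 := hsq y _ (hBn.conj_mem s hs x)
    have h2 := hsq x s hs
    have h3 := hsq (x * y) s hs
    have e1 : (x * y) * (x * (y * s * y⁻¹) * x⁻¹) * (x * y)⁻¹ = s := by
      calc _ = (x * y) ^ 2 * s * ((x * y) ^ 2)⁻¹ := by rw [sq]; group
        _ = s := by rw [h3.eq, mul_inv_cancel_right]
    have e2 : (x * y) * (y * (x * s * x⁻¹) * y⁻¹) * (x * y)⁻¹ = s := by
      calc _ = x * (y ^ 2 * (x * s * x⁻¹) * (y ^ 2)⁻¹) * x⁻¹ := by rw [sq]; group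
        _ = x ^ 2 * s * (x ^ 2)⁻¹ := by rw [h1.eq, mul_inv_cancel_right, sq]; group
        _ = s := by rw [h2.eq, mul_inv_cancel_right]
    exact mul_left_cancel (mul_right_cancel (e1.trans e2.symm))
  -- Conjugation by x reverses the exponent of w only, so c and w are independent.
  have hspan0 : ∀ i j : ℤ, c ^ i * w ^ j = 1 → i = 0 ∧ j = 0 := by
    intro i j e
    have e2 : c ^ i * w ^ (-j) = 1 := by
      have : x * (c ^ i * w ^ j) * x⁻¹ = 1 := by rw [e]; group
      rwa [← conj_mul, ← conj_zpow, ← conj_zpow, hxc, hxw, inv_zpow, ← zpow_neg] at this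
    have hj : j = 0 := by
      by_contra hj
      refine hw1 (hG w (2 * j) (by omega) ?_)
      rw [two_mul, zpow_add]
      rw [zpow_neg, mul_inv_eq_one] at e2
      rw [← e2, ← e, e2]
    subst hj
    refine ⟨?_, rfl⟩
    by_contra hi
    exact hc1 (hG c i hi (by simpa using e))
  have hspan : ∀ s : G, ∃ i j k : ℤ, k ≠ 0 ∧ s ^ k = c ^ i * w ^ j := by
    intro s
    obtain ⟨i, j, k, h0, e⟩ := h.dep' c w s
    refine ⟨i, j, -k, ?_, by rw [zpow_neg]; exact (eq_inv_of_mul_eq_one_left e).symm⟩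
    intro hk
    obtain rfl : k = 0 := by omega
    have := hspan0 i j (by simpa using e)
    omega
  have fix : ∀ z : G, z * c * z⁻¹ = c → z * w * z⁻¹ = w → z ∈ centralizerSquares G := by
    intro z hzc hzw
    refine mem_centralizerSquares.mpr fun s hs => ?_
    obtain ⟨i, j, k, hk, e⟩ := hspan s
    refine hG.commute_of_commute_zpow (hcomm _ (hBn.conj_mem s hs z) _ hs) hk ?_
    rw [e]
    exact (show Commute z c from mul_inv_eq_iff_eq_mul.mp hzc).zpow_right i |>.mul_right
      ((show Commute z w from mul_inv_eq_iff_eq_mul.mp hzw).zpow_right j)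
  -- Inverting c and w would invert a power of z², which z also fixes; so z would be torsion.
  have noinv : ∀ z : G, z * c * z⁻¹ = c⁻¹ → z * w * z⁻¹ = w⁻¹ → z ∈ centralizerSquares G := by
    intro z hzc hzw
    obtain ⟨i, j, k, hk, e⟩ := hspan (z ^ 2)
    have h1 : z * (z ^ 2) ^ k * z⁻¹ = ((z ^ 2) ^ k)⁻¹ := by
      rw [e, ← conj_mul, ← conj_zpow, ← conj_zpow, hzc, hzw, mul_inv_rev, inv_zpow, inv_zpow,
        (hcomm _ (inv_mem (zpow_mem hcB i)) _ (inv_mem (zpow_mem hw j))).eq]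
    have h2 : z * (z ^ 2) ^ k * z⁻¹ = (z ^ 2) ^ k := by group
    rw [h2] at h1
    have h3 : z ^ (4 * k) = 1 := by
      have := mul_eq_one_iff_eq_inv.mpr h1
      rw [← this]; group
    rw [hG z _ (by omega) h3]
    exact one_mem _
  have hycB := hBn.conj_mem c hcB y
  have hywB := hBn.conj_mem w hw y
  have hyc : y * c * y⁻¹ = c ∨ y * c * y⁻¹ = c⁻¹ := by
    obtain ⟨i, j, k, h0, e⟩ := h.dep' c (y * c * y⁻¹) w
    have e2 : c ^ i * (y * c * y⁻¹) ^ j * w ^ (-k) = 1 := by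
      have : x * (c ^ i * (y * c * y⁻¹) ^ j * w ^ k) * x⁻¹ = 1 := by rw [e]; group
      rwa [← conj_mul, ← conj_mul, ← conj_zpow, ← conj_zpow, ← conj_zpow, hcommYX c hcB, hxc, hxw,
        inv_zpow, ← zpow_neg] at this
    -- Conjugation by x fixes c and its y-conjugate but inverts w, so w cannot occur in the
    -- relation.
    have hk : k = 0 := by
      by_contra hk
      refine hw1 (hG w (k - -k) (by omega) ?_)
      rw [zpow_sub, mul_left_cancel (e.trans e2.symm), mul_inv_cancel]
    exact eq_or_eq_inv_of_dep hG hc1 (hcomm _ hycB _ hcB) (hsq y c hcB)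
      (show i ≠ 0 ∨ j ≠ 0 by tauto) (by simpa [hk] using e)
  have hyw : y * w * y⁻¹ = w ∨ y * w * y⁻¹ = w⁻¹ := by
    obtain ⟨k, i, j, h0, e⟩ := h.dep' c w (y * w * y⁻¹)
    have hyxw : x * (y * w * y⁻¹) * x⁻¹ = (y * w * y⁻¹)⁻¹ := by
      rw [hcommYX w hw, hxw]; group
    have e2 : c ^ k * (w ^ i * (y * w * y⁻¹) ^ j)⁻¹ = 1 := by
      have : x * (c ^ k * w ^ i * (y * w * y⁻¹) ^ j) * x⁻¹ = 1 := by rw [e]; group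
      rw [← conj_mul, ← conj_mul, ← conj_zpow, ← conj_zpow, ← conj_zpow, hyxw, hxc, hxw,
        inv_zpow, inv_zpow] at this
      rw [mul_inv_rev,
        (hcomm _ (inv_mem (zpow_mem hywB j)) _ (inv_mem (zpow_mem hw i))).eq, ← mul_assoc, this]
    rw [mul_assoc] at e
    have hk : k = 0 := by
      by_contra hk
      refine hc1 (hG c (k + k) (by omega) ?_)
      rw [zpow_add]
      nth_rw 2 [mul_inv_eq_one.mp e2]
      exact e
    rw [hk, zpow_zero, one_mul] at e
    exact eq_or_eq_inv_of_dep hG hw1 (hcomm _ hywB _ hw) (hsq y w hw)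
      (show i ≠ 0 ∨ j ≠ 0 by tauto) e
  have comp : ∀ s : G, y * x * s * (y * x)⁻¹ = y * (x * s * x⁻¹) * y⁻¹ := fun s => by group
  have conj_inv' : ∀ s : G, y * s⁻¹ * y⁻¹ = (y * s * y⁻¹)⁻¹ := fun s => by group
  rcases hyc with hyc | hyc <;> rcases hyw with hyw | hyw
  · exact hy (fix y hyc hyw)
  · exact hg (fix _ (by rw [comp, hxc, hyc]) (by rw [comp, hxw, conj_inv', hyw, inv_inv]))
  · exact hg (noinv _ (by rw [comp, hxc, hyc]) (by rw [comp, hxw, conj_inv', hyw]))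
  · exact hy (noinv y hyc hyw)

end IsVirtuallyAbelianRankLETwo

end VirtuallyAbelian

/-! ### From dependence relations to the rank over ℤ. -/

section Rank

theorem rank_int_le_two {M : Type*} [AddCommGroup M]
    (h : ∀ x y z : M, ∃ i j k : ℤ, (i ≠ 0 ∨ j ≠ 0 ∨ k ≠ 0) ∧ i • x + j • y + k • z = 0) :
    Module.rank ℤ M ≤ 2 := by
  refine (rank_le (n := 2) fun s hs => ?_).trans_eq Nat.cast_ofNat
  by_contra hcard
  obtain ⟨a, ha, b, hb, c, hc, hab, hac, hbc⟩ := Finset.two_lt_card.mp (not_le.mp hcard)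
  have hinj : Function.Injective (![⟨a, ha⟩, ⟨b, hb⟩, ⟨c, hc⟩] : Fin 3 → s) := by
    intro i j hij
    fin_cases i <;> fin_cases j <;> simp_all
  have h1 := Fintype.linearIndependent_iff.mp (hs.comp _ hinj)
  obtain ⟨i, j, k, h0, e⟩ := h a b c
  have h2 := h1 ![i, j, k] (by simpa [Fin.sum_univ_three] using e)
  have h3 : i = 0 := h2 0
  have h4 : j = 0 := h2 1
  have h5 : k = 0 := h2 2
  omega

theorem rank_int_le_one {M : Type*} [AddCommGroup M]
    (h : ∀ x y : M, ∃ i j : ℤ, (i ≠ 0 ∨ j ≠ 0) ∧ i • x = j • y) :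
    Module.rank ℤ M ≤ 1 := by
  refine (rank_le (n := 1) fun s hs => ?_).trans_eq Nat.cast_one
  by_contra hcard
  obtain ⟨a, ha, b, hb, hab⟩ := Finset.one_lt_card.mp (not_le.mp hcard)
  have hinj : Function.Injective (![⟨a, ha⟩, ⟨b, hb⟩] : Fin 2 → s) := by
    intro i j hij
    fin_cases i <;> fin_cases j <;> simp_all
  have h1 := Fintype.linearIndependent_iff.mp (hs.comp _ hinj)
  obtain ⟨i, j, h0, e⟩ := h a b
  have h2 := h1 ![i, -j] (by simp [e])
  have h3 : i = 0 := h2 0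
  have h4 : -j = 0 := h2 1
  omega

theorem rank_additive_eq_one {C : Type*} [CommGroup C] (hC : IsTorsionFreeGroup C) {a : C}
    (ha : a ≠ 1) (h : ∀ x y : C, ∃ i j : ℤ, (i ≠ 0 ∨ j ≠ 0) ∧ x ^ i = y ^ j) :
    Module.rank ℤ (Additive C) = 1 := by
  refine le_antisymm (rank_int_le_one h) ?_
  have hli : LinearIndependent ℤ ![Additive.ofMul a] := by
    rw [Fintype.linearIndependent_iff]
    intro g hg i
    fin_cases i
    by_contra h0
    exact ha (hC a (g 0) h0 (by simpa [← ofMul_zpow] using hg))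
  simpa using hli.cardinal_lift_le_rank

theorem rank_additive_eq_two {C : Type*} [CommGroup C]
    (h3 : ∀ x y z : C, ∃ i j k : ℤ, (i ≠ 0 ∨ j ≠ 0 ∨ k ≠ 0) ∧ x ^ i * y ^ j * z ^ k = 1)
    (h2 : ¬ ∀ x y : C, ∃ i j : ℤ, (i ≠ 0 ∨ j ≠ 0) ∧ x ^ i = y ^ j) :
    Module.rank ℤ (Additive C) = 2 := by
  refine le_antisymm (rank_int_le_two h3) ?_
  push Not at h2
  obtain ⟨x, y, hxy⟩ := h2
  have hli : LinearIndependent ℤ ![Additive.ofMul x, Additive.ofMul y] := by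
    rw [LinearIndependent.pair_iff]
    intro s t hst
    by_contra h0
    refine hxy s (-t) (by omega) ?_
    rw [zpow_neg]
    exact eq_inv_of_mul_eq_one_left hst
  simpa using hli.cardinal_lift_le_rank

end Rank

/-! ### The character of G on a, and the splitting over ℤ. -/

section Splitting

variable {G : Type u} [Group G]

/-- A group with a nontrivial homomorphism to `ℤ` is the semidirect product of the kernel
and `ℤ`. -/
theorem exists_mulEquiv_semidirectProduct_int (C : Subgroup G) [C.Normal]
    (v : G →* Multiplicative ℤ) (hC : v.ker = C) (hv : ∃ t, v t ≠ 1) :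
    ∃ (φ : Multiplicative ℤ →* MulAut C) (e : G ≃* C ⋊[φ] Multiplicative ℤ),
      ∀ a : C, e (a : G) = SemidirectProduct.inl a := by
  -- The image of v is cyclic; a preimage s of a generator generates the complement.
  obtain ⟨r, hr⟩ := (Subgroup.isCyclic_iff_exists_zpowers_eq_top v.range).mp inferInstance
  obtain ⟨s, rfl⟩ : r ∈ v.range := hr ▸ Subgroup.mem_zpowers r
  obtain ⟨t, ht⟩ := hv
  have hvs : ∀ k : ℤ, v s ^ k = 1 → k = 0 := by
    intro k hk
    have h1 := congrArg Multiplicative.toAdd hk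
    rw [toAdd_zpow, toAdd_one, smul_eq_mul, mul_eq_zero] at h1
    refine h1.resolve_right fun h2 => ht ?_
    have h3 : v t ∈ Subgroup.zpowers (v s) := hr ▸ ⟨t, rfl⟩
    obtain ⟨j, hj⟩ := h3
    rw [← hj]
    change v s ^ j = 1
    rw [show v s = 1 from h2, one_zpow]
  let φ : Multiplicative ℤ →* MulAut C := MulAut.conjNormal.comp (zpowersHom G s)
  let F : C ⋊[φ] Multiplicative ℤ →* G := SemidirectProduct.lift C.subtype (zpowersHom G s)
    fun n => by ext c; exact MulAut.conjNormal_apply (s ^ n.toAdd) c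
  have hF : ∀ x, F x = x.left * s ^ x.right.toAdd := fun x => rfl
  have hinj : Function.Injective F := by
    rw [injective_iff_map_eq_one]
    intro x hx
    rw [hF] at hx
    have h1 : v (x.left * s ^ x.right.toAdd) = 1 := by rw [hx, map_one]
    have h2 : v x.left = 1 := by
      rw [← MonoidHom.mem_ker, hC]; exact x.left.2
    rw [map_mul, h2, one_mul, map_zpow] at h1
    have h3 := hvs _ h1
    rw [h3, zpow_zero, mul_one] at hx
    exact SemidirectProduct.ext (Subtype.ext hx) h3
  have hsurj : Function.Surjective F := by
    intro g
    have h3 : v g ∈ Subgroup.zpowers (v s) := hr ▸ ⟨g, rfl⟩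
    obtain ⟨j, hj⟩ := h3
    have h4 : g * (s ^ j)⁻¹ ∈ C := by
      rw [← hC, MonoidHom.mem_ker, map_mul, map_inv, map_zpow, mul_inv_eq_one]
      exact hj.symm
    exact ⟨⟨⟨_, h4⟩, Multiplicative.ofAdd j⟩, inv_mul_cancel_right g (s ^ j)⟩
  refine ⟨φ, (MulEquiv.ofBijective F ⟨hinj, hsurj⟩).symm, fun a => ?_⟩
  have ha : F (SemidirectProduct.inl a) = a := by simp [hF]
  exact (MulEquiv.symm_apply_eq (MulEquiv.ofBijective F ⟨hinj, hsurj⟩)).mpr ha.symm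

theorem exists_padicValRat_ne_zero {q : ℚ} (h0 : q ≠ 0) (h1 : q ≠ 1) (h2 : q ≠ -1) :
    ∃ p : ℕ, p.Prime ∧ padicValRat p q ≠ 0 := by
  have hnum : q.num ≠ 0 := Rat.num_ne_zero.mpr h0
  by_cases hn : q.num.natAbs = 1
  · have hd : q.den ≠ 1 := by
      intro hd
      have h3 : q = q.num := (Rat.den_eq_one_iff q).mp hd |>.symm
      rcases Int.natAbs_eq_iff.mp hn with h | h
      · exact h1 (by rw [h3, h]; norm_num)
      · exact h2 (by rw [h3, h]; norm_num)
    have hp := Nat.minFac_prime hd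
    have := Fact.mk hp
    refine ⟨_, hp, ?_⟩
    have h4 : padicValInt q.den.minFac q.num = 0 := by simp [padicValInt, hn]
    have h5 := one_le_padicValNat_of_dvd q.den_ne_zero (Nat.minFac_dvd q.den)
    rw [padicValRat, h4]
    omega
  · have hp := Nat.minFac_prime hn
    have := Fact.mk hp
    refine ⟨_, hp, ?_⟩
    have hdvd := Nat.minFac_dvd q.num.natAbs
    have h4 : padicValNat q.num.natAbs.minFac q.den = 0 := by
      refine padicValNat.eq_zero_of_not_dvd fun h => hp.one_lt.ne' ?_
      exact Nat.dvd_one.mp (q.reduced.gcd_eq_one ▸ Nat.dvd_gcd hdvd h)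
    have h5 := one_le_padicValNat_of_dvd (Int.natAbs_ne_zero.mpr hnum) hdvd
    rw [padicValRat, h4, padicValInt]
    omega

namespace IsRankOneByRankOne

variable {a : G}

theorem exists_conj_zpow_eq (hG : IsTorsionFreeGroup G) (h : IsRankOneByRankOne G a) (g : G) :
    ∃ m n : ℤ, m ≠ 0 ∧ n ≠ 0 ∧ (g * a * g⁻¹) ^ n = a ^ m := by
  obtain ⟨n, m, hmn, e⟩ := h.rank.dep (g * a * g⁻¹)
    (mem_centralizer_singleton.mpr (h.normal a g (Commute.refl a))) a
    (mem_centralizer_singleton.mpr (Commute.refl a))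
  have hga : g * a * g⁻¹ ≠ 1 := by simpa using h.ne_one
  refine ⟨m, n, ?_, ?_, e⟩
  · rintro rfl
    exact hga (hG _ n (by tauto) (by simpa using e))
  · rintro rfl
    exact h.ne_one (hG _ m (by tauto) (by simpa using e.symm))

/-- Conjugation by g multiplies a by the rational m/n, which is well defined because a has infinite
order. -/
theorem exists_character (hG : IsTorsionFreeGroup G) (h : IsRankOneByRankOne G a) :
    ∃ χ : G →* ℚ, (∀ g, χ g ≠ 0) ∧ ∀ g, χ g = 1 ↔ Commute g a := by
  choose m n hm hn e using h.exists_conj_zpow_eq hG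
  have uniq : ∀ (g : G) (m' n' : ℤ), n' ≠ 0 → (g * a * g⁻¹) ^ n' = a ^ m' →
      (m g : ℚ) / n g = m' / n' := by
    intro g m' n' hn' e'
    have h1 : a ^ (m g * n') = a ^ (m' * n g) := by
      rw [zpow_mul, ← e, zpow_mul, ← e', zpow_comm]
    have h2 : m g * n' = m' * n g := by
      by_contra hne
      exact h.ne_one (hG a _ (sub_ne_zero.mpr hne) (by rw [zpow_sub, h1, mul_inv_cancel]))
    rw [div_eq_div_iff (by exact_mod_cast hn g) (by exact_mod_cast hn')]
    exact_mod_cast h2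
  refine ⟨⟨⟨fun g => (m g : ℚ) / n g, ?_⟩, ?_⟩, fun g => ?_, fun g => ⟨fun hg => ?_, fun hg => ?_⟩⟩
  · rw [uniq 1 1 1 one_ne_zero (by simp)]
    simp
  · intro g k
    change (m (g * k) : ℚ) / n (g * k) = m g / n g * (m k / n k)
    rw [uniq (g * k) (m g * m k) (n g * n k) (mul_ne_zero (hn g) (hn k))]
    · push_cast
      rw [div_mul_div_comm]
    · have h1 : g * k * a * (g * k)⁻¹ = g * (k * a * k⁻¹) * g⁻¹ := by group
      rw [h1, conj_zpow, mul_comm (n g), zpow_mul, e k, ← zpow_mul, mul_comm, zpow_mul,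
        ← conj_zpow, ← conj_zpow, e g]
      rw [zpow_mul]
  · exact div_ne_zero (by exact_mod_cast hm g) (by exact_mod_cast hn g)
  · change (m g : ℚ) / n g = 1 at hg
    rw [div_eq_one_iff_eq (by exact_mod_cast hn g)] at hg
    have hg : m g = n g := by exact_mod_cast hg
    have h1 := e g
    rw [hg] at h1
    exact mul_inv_eq_iff_eq_mul.mp
      (hG.eq_of_zpow_eq (h.normal a g (Commute.refl a)) (hn g) h1)
  · change (m g : ℚ) / n g = 1
    rw [uniq g 1 1 one_ne_zero (by rw [hg.eq, mul_inv_cancel_right])]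
    simp

/-- Some prime p has nonzero valuation at χ(t). As G/C(a) is torsion-free of rank one, composing χ
with this valuation does not enlarge the kernel. -/
theorem exists_hom_int (hG : IsTorsionFreeGroup G) (h : IsRankOneByRankOne G a) :
    ∃ v : G →* Multiplicative ℤ, v.ker = Subgroup.centralizer {a} ∧ ∃ t, v t ≠ 1 := by
  obtain ⟨χ, hχ0, hχ⟩ := h.exists_character hG
  obtain ⟨t, ht⟩ := h.exists_not_commute
  -- The value -1 is excluded: t² would commute with a, and then so would t.
  obtain ⟨p, hp, hpt⟩ := exists_padicValRat_ne_zero (hχ0 t) (fun h1 => ht ((hχ t).mp h1)) (by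
    intro h1
    refine ht (h.commute_of_commute_zpow hG two_ne_zero ((hχ _).mp ?_))
    rw [zpow_ofNat, map_pow, h1]; norm_num)
  have := Fact.mk hp
  let v : G →* Multiplicative ℤ :=
    { toFun := fun g => Multiplicative.ofAdd (padicValRat p (χ g))
      map_one' := by simp
      map_mul' := fun g k => by rw [map_mul, padicValRat.mul (hχ0 g) (hχ0 k), ofAdd_add] }
  have hvt : v t ≠ 1 := fun h1 => hpt (congrArg Multiplicative.toAdd h1)
  refine ⟨v, ?_, t, hvt⟩
  ext g
  rw [MonoidHom.mem_ker, mem_centralizer_singleton]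
  constructor
  · intro hg
    obtain ⟨m, n, hmn, hc⟩ := h.dep g t
    have h1 : v (g ^ m * t ^ n) = 1 := by
      change Multiplicative.ofAdd (padicValRat p (χ _)) = 1
      rw [(hχ _).mpr hc]; simp
    rw [map_mul, map_zpow, map_zpow, hg, one_zpow, one_mul] at h1
    have hn : n = 0 := by
      have h2 := congrArg Multiplicative.toAdd h1
      rw [toAdd_zpow, toAdd_one, smul_eq_mul, mul_eq_zero] at h2
      exact h2.resolve_right hpt
    subst hn
    rw [zpow_zero, mul_one] at hc
    exact h.commute_of_commute_zpow hG (by tauto) hc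
  · intro hg
    change Multiplicative.ofAdd (padicValRat p (χ _)) = 1
    rw [(hχ _).mpr hg]; simp

end IsRankOneByRankOne

end Splitting

/-! ### The two cases of the theorem. -/

theorem mainTheorem1 (G : Type u) [Group G]
    (htf : ∀ g : G, IsOfFinOrder g → g = 1)
    (hEA : IsElementaryAmenable G)
    (hh : HasHirschLength G 2) :
    ∃ _ : IsMulCommutative (hirschPlotkinRadical G),
      (Module.rank ℤ (Additive (hirschPlotkinRadical G)) = 1 ∧
        ∃ (φ : Multiplicative ℤ →* MulAut (hirschPlotkinRadical G))
          (e : G ≃* hirschPlotkinRadical G ⋊[φ] Multiplicative ℤ),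
          ∀ a : hirschPlotkinRadical G, e (a : G) = SemidirectProduct.inl a) ∨
      (Module.rank ℤ (Additive (hirschPlotkinRadical G)) = 2 ∧
        (hirschPlotkinRadical G).FiniteIndex ∧ (hirschPlotkinRadical G).index ≤ 2) := by
  have hG := isTorsionFreeGroup_of_isOfFinOrder htf
  rcases hh.structure.2.2 le_rfl hG with h | ⟨a, h⟩
  · have hR := h.hirschPlotkinRadical_eq hG
    generalize hirschPlotkinRadical G = R at hR ⊢
    subst hR
    have hcomm : IsMulCommutative (centralizerSquares G) :=
      ⟨⟨fun x y => Subtype.ext (hG.commute_centralizerSquares _ x.2 _ y.2).eq⟩⟩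
    refine ⟨hcomm, Or.inr ⟨?_, ?_⟩⟩
    · refine rank_additive_eq_two (fun x y z => ?_) fun h2 => ?_
      · obtain ⟨i, j, k, h0, e⟩ := h.dep' (x : G) y z
        exact ⟨i, j, k, h0, Subtype.ext e⟩
      -- Rank at most one for C would make the squares of any two elements of G dependent,
      -- contradicting length 2.
      · have h1 := hh.le_one_of_dep.2 fun x y => by
          obtain ⟨i, j, hij, e⟩ := h2 ⟨x ^ 2, h.sq_mem_centralizerSquares x⟩
            ⟨y ^ 2, h.sq_mem_centralizerSquares y⟩
          refine ⟨2 * i, 2 * j, by omega, ?_⟩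
          rw [zpow_mul, zpow_mul, zpow_ofNat, zpow_ofNat]
          exact congrArg Subtype.val e
        exact absurd h1 (by decide)
    · by_cases htop : centralizerSquares G = ⊤
      · rw [htop]
        exact ⟨inferInstance, by simp⟩
      · have h2 : (centralizerSquares G).index = 2 := by
          rw [Subgroup.index_eq_two_iff]
          obtain ⟨x, -, hx⟩ := SetLike.exists_of_lt (lt_top_iff_ne_top.mpr htop)
          refine ⟨x, fun b => ?_⟩
          by_cases hb : b ∈ centralizerSquares G
          · exact Or.inr ⟨hb, fun h1 => hx ((Subgroup.mul_mem_cancel_left _ hb).mp h1)⟩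
          · exact Or.inl ⟨h.mul_mem_of_notMem hG hx hb, hb⟩
        exact ⟨⟨by omega⟩, h2.le⟩
  · have hR := h.hirschPlotkinRadical_eq hG
    obtain ⟨v, hv, ht⟩ := h.exists_hom_int hG
    rw [← hR] at hv
    have hrank := hR ▸ h.rank
    have haR : a ∈ hirschPlotkinRadical G :=
      hR ▸ mem_centralizer_singleton.mpr (Commute.refl a)
    have hcomm : IsMulCommutative (hirschPlotkinRadical G) :=
      ⟨⟨fun x y => Subtype.ext (hrank.comm _ x.2 _ y.2).eq⟩⟩
    have : (hirschPlotkinRadical G).Normal := hv ▸ v.normal_ker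
    refine ⟨hcomm, Or.inl ⟨?_, exists_mulEquiv_semidirectProduct_int _ v hv ht⟩⟩
    refine rank_additive_eq_one (hG.subgroup _) (a := ⟨a, haR⟩)
      (fun h1 => h.ne_one (congrArg Subtype.val h1)) fun x y => ?_
    obtain ⟨i, j, hij, e⟩ := hrank.dep _ x.2 _ y.2
    exact ⟨i, j, hij, Subtype.ext e⟩
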